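/- Let $R$ be a commutative artinian ring and let $\Lambda$ be an Artin $R$-algebra, i.e. an $R$-algebra which is finitely generated as an $R$-module. Let $\mathrm{mod}(\Lambda)$ and $\mathrm{proj}(\Lambda)$ be the categories of finitely generated (respectively, finitely generated projective) left $\Lambda$-modules. For an object $A$ of an additive category, $\mathrm{add}(A)$ is the class of all direct summands of finite direct sums of copies of $A$. For each $M\in\mathrm{mod}(\Lambda)$ fix a minimal projective resolution $$\cdots\to P^{-2}(M)\xrightarrow{\pi^{-2}_M}P^{-1}(M)\xrightarrow{\pi^{-1}_M}P^{0}(M)\xrightarrow{\pi^{0}_M}M\to 0 ,$$ and let $P^\bullet(M)$ be the cochain complex with $P^i(M)$ in degree $i\le 0$ and $0$ in degrees $i>0$. For an integer $n\ge 0$, $P^\bullet_{\ge -n}(M)$ is the truncated complex that agrees with $P^\bullet(M)$ in degrees $\ge -n$ and is $0$ in degrees $<-n$. Put $\Omega^0(M):=M$ and $\Omega^i(M):=\mathrm{Ker}(\pi_M^{-i+1})$ for $i\ge 1$. Let $k$ be the injective envelope of the $R$-module $R/\mathrm{rad}(R)$, let $\nu(P):=\mathrm{Hom}_R(\mathrm{Hom}_\Lambda(P,\Lambda),k)$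 be the Nakayama functor on $\mathrm{proj}(\Lambda)$, and let $\tau(M):=\mathrm{Ker}(\nu(\pi^{-1}_M))$ and $\tau_n(M):=\tau(\Omega^{n-1}(M))$ for $n\ge 1$. The $\tau_n$-perpendicular category of $M$ is $$M^{\perp_{\tau_n}}:=\{N\in\mathrm{mod}(\Lambda)\;:\;\mathrm{Hom}_\Lambda(N,\tau_n(M))=0\text{ and }\mathrm{Ext}^i_\Lambda(M,N)=0\text{ for all }1\le i\le n-1\},$$ and $\mathrm{gen}_n(M)$ is the class of all $X\in\mathrm{mod}(\Lambda)$ admitting an exact sequence $M_n\to M_{n-1}\to\cdots\to M_1\to X\to 0$ with $M_i\in\mathrm{add}(M)$ for all $1\le i\le n$. Let $\mathsf{K}^b(\mathrm{proj}(\Lambda))$ be the homotopy category of bounded cochain complexes over $\mathrm{proj}(\Lambda)$. A complex $P^\bullet\in\mathsf{K}^b(\mathrm{proj}(\Lambda))$ is silting if $\mathrm{Hom}_{\mathsf{K}^b(\mathrm{proj}(\Lambda))}(P^\bullet,P^\bullet[i])=0$ for all $i>0$ and $\mathsf{K}^b(\mathrm{proj}(\Lambda))$ is its own smallest triangulated subcategory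 containing $\mathrm{add}(P^\bullet)$. A module $M\in\mathrm{mod}(\Lambda)$ is $\tau_n$-tilting if $P^\bullet_{\ge -n}(M)$ is silting in $\mathsf{K}^b(\mathrm{proj}(\Lambda))$. **Theorem.** Let $n\ge 1$ and $M\in\mathrm{mod}(\Lambda)$. If $M$ is $\tau_n$-tilting, then $M^{\perp_{\tau_n}}=\mathrm{gen}_n(M)$. -/

import Mathlib

open CategoryTheory Limits
open scoped ZeroObject

universe u

namespace TauTilting

/-! ### Artin algebras -/

/-- `Λ` is an Artin `R`-algebra: `R` is a commutative artinian ring and `Λ` is an `R`-algebra which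
is finitely generated as an `R`-module. -/
class IsArtinAlgebra (R Λ : Type u) [CommRing R] [Ring Λ] [Algebra R Λ] : Prop where
  isArtinianRing_base : IsArtinianRing R
  finite : Module.Finite R Λ

theorem IsArtinAlgebra.isArtinianRing (R Λ : Type u) [CommRing R] [Ring Λ] [Algebra R Λ]
    [h : IsArtinAlgebra R Λ] : IsArtinianRing Λ :=
  have := h.isArtinianRing_base
  have := h.finite
  IsArtinianRing.of_finite R Λ

/-! ### Direct summands of finite direct sums -/

/-- `add(A)`: the objects which are direct summands of finite direct sums of copies of `A`. -/
def addClosure {C : Type*} [Category C] [Preadditive C] [HasBinaryBiproducts C] [HasFiniteBiproducts C]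
    (A : C) : ObjectProperty C :=
  fun X => ∃ (Y : C) (k : ℕ), Nonempty (X ⊞ Y ≅ ⨁ fun _ : Fin k => A)

/-! ### The injective envelope of `R / rad R` -/

/-- A submodule `U` of `E` is essential if it meets every nonzero submodule of `E`. -/
def IsEssential {R E : Type*} [Ring R] [AddCommGroup E] [Module R E]
    (U : Submodule R E) : Prop :=
  ∀ N : Submodule R E, U ⊓ N = ⊥ → N = ⊥

/-- An injective envelope of the module `X`: an essential embedding of `X` in an injective
module. -/
structure InjectiveEnvelope (R : Type u) [Ring R] (X : Type u) [AddCommGroup X] [Module R X] where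
  E : ModuleCat.{u} R
  ι : X →ₗ[R] E
  injective_E : Module.Injective R E
  injective_ι : Function.Injective ι
  essential : IsEssential (LinearMap.range ι)

theorem InjectiveEnvelope.nonempty (R : Type u) [Ring R] (X : Type u) [AddCommGroup X]
    [Module R X] : Nonempty (InjectiveEnvelope R X) := by
  let I : ModuleCat.{u} R := Injective.under (ModuleCat.of R X)
  let i : X →ₗ[R] I := (Injective.ι (ModuleCat.of R X)).hom
  have hi : Function.Injective i := (ModuleCat.mono_iff_injective _).1 inferInstance
  have hI : Module.Injective R I :=
    (Module.injective_iff_injective_object R I).2 (inferInstanceAs (Injective (Injective.under _)))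
  let A : Set (Submodule R I) :=
    {E | LinearMap.range i ≤ E ∧ ∀ N ≤ E, LinearMap.range i ⊓ N = ⊥ → N = ⊥}
  have hchain {c : Set (Submodule R I)} (hc : IsChain (· ≤ ·) c) (hne : c.Nonempty) (x : I)
      (hx : x ∈ sSup c) : ∃ E ∈ c, x ∈ E :=
    (Submodule.mem_sSup_of_directed hne hc.directedOn).1 hx
  obtain ⟨E, -, hE⟩ := zorn_le_nonempty₀ A (fun c hcA hc y hy => by
    refine ⟨sSup c, ⟨(hcA hy).1.trans (le_sSup hy), fun N hN h => ?_⟩, fun z hz => le_sSup hz⟩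
    rw [eq_bot_iff]
    intro x hx
    obtain ⟨F, hF, hxF⟩ := hchain hc ⟨y, hy⟩ x (hN hx)
    have := (hcA hF).2 (N ⊓ F) inf_le_right (by rw [← inf_assoc, h, bot_inf_eq])
    exact this ▸ (⟨hx, hxF⟩ : x ∈ N ⊓ F)) (LinearMap.range i)
    ⟨le_rfl, fun N hN h => by rwa [inf_eq_right.2 hN] at h⟩
  obtain ⟨C, -, hC⟩ := zorn_le_nonempty₀ {C : Submodule R I | C ⊓ E = ⊥} (fun c hcA hc y hy => by
    refine ⟨sSup c, ?_, fun z hz => le_sSup hz⟩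
    rw [Set.mem_ofPred_eq, eq_bot_iff]
    intro x hx
    obtain ⟨F, hF, hxF⟩ := hchain hc ⟨y, hy⟩ x hx.1
    have h : F ⊓ E = ⊥ := hcA hF
    exact h ▸ (⟨hxF, hx.2⟩ : x ∈ F ⊓ E)) ⊥ (by simp)
  have hCE : C ⊓ E = ⊥ := hC.prop
  let q : E →ₗ[R] I ⧸ C := C.mkQ ∘ₗ E.subtype
  have hq : Function.Injective q := by
    rw [← LinearMap.ker_eq_bot, eq_bot_iff]
    intro x hx
    have hx' : (x : I) ∈ C := by simpa [q] using hx
    have : (x : I) ∈ C ⊓ E := ⟨hx', x.2⟩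
    rw [hCE] at this
    simpa using this
  have hqe (N : Submodule R (I ⧸ C)) (h : LinearMap.range q ⊓ N = ⊥) : N = ⊥ := by
    have h1 : C ≤ N.comap C.mkQ := by
      intro x hx
      have : C.mkQ x = 0 := by simpa using hx
      rw [Submodule.mem_comap, this]
      exact N.zero_mem
    have h2 : N.comap C.mkQ ⊓ E = ⊥ := by
      rw [eq_bot_iff]
      rintro x ⟨hx, hxE⟩
      have : C.mkQ x ∈ LinearMap.range q ⊓ N := ⟨⟨⟨x, hxE⟩, rfl⟩, hx⟩
      rw [h] at this
      have hxC : x ∈ C := by simpa using this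
      exact hCE ▸ (⟨hxC, hxE⟩ : x ∈ C ⊓ E)
    have h3 : N.comap C.mkQ ≤ C := hC.le_of_ge h2 h1
    rw [eq_bot_iff]
    intro y hy
    obtain ⟨x, rfl⟩ := C.mkQ_surjective y
    simpa using h3 hy
  obtain ⟨g, hg⟩ := hI.out q hq E.subtype
  have hgi : LinearMap.ker g = ⊥ := hqe _ (by
    rw [eq_bot_iff]
    rintro _ ⟨⟨x, rfl⟩, hx⟩
    have : (x : I) = 0 := by
      have := hg x
      rw [LinearMap.mem_ker.1 hx] at this
      simpa using this.symm
    have : x = 0 := by ext; simpa using this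
    simp [this])
  have hEg : E ≤ LinearMap.range g := fun x hx => ⟨q ⟨x, hx⟩, hg ⟨x, hx⟩⟩
  have hgA : LinearMap.range g ∈ A := by
    refine ⟨hE.prop.1.trans hEg, fun N hN h => ?_⟩
    have h1 : N ⊓ E = ⊥ := hE.prop.2 _ inf_le_right (by rw [← inf_assoc, h, bot_inf_eq])
    have h2 : N.comap g = ⊥ := hqe _ (by
      rw [eq_bot_iff]
      rintro _ ⟨⟨x, rfl⟩, hx⟩
      have h3 : (x : I) ∈ N ⊓ E := ⟨by have := hg x; simp at this; rw [← this]; exact hx, x.2⟩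
      rw [h1] at h3
      have : x = 0 := by ext; simpa using h3
      simp [this])
    rw [eq_bot_iff]
    intro y hy
    obtain ⟨x, rfl⟩ := hN hy
    have : x ∈ N.comap g := hy
    rw [h2] at this
    simp [(Submodule.mem_bot _).1 this]
  have hgE : LinearMap.range g ≤ E := hE.le_of_ge hgA hEg
  let r : I →ₗ[R] E := LinearMap.codRestrict E (g ∘ₗ C.mkQ) (fun x => hgE ⟨_, rfl⟩)
  have hr (x : E) : r x = x := by ext; exact hg x
  refine ⟨⟨ModuleCat.of R E, LinearMap.codRestrict E i fun x => hE.prop.1 ⟨x, rfl⟩, ⟨?_⟩, ?_, ?_⟩⟩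
  · intro X Y _ _ _ _ f hf φ
    obtain ⟨ψ, hψ⟩ := hI.out f hf (E.subtype ∘ₗ φ)
    exact ⟨r ∘ₗ ψ, fun x => by simpa [hψ x] using hr (φ x)⟩
  · intro x y h
    exact hi (congrArg Subtype.val h)
  · intro N hN
    have := hE.prop.2 (N.map E.subtype) (Submodule.map_subtype_le _ _) (by
      rw [eq_bot_iff]
      rintro _ ⟨⟨x, rfl⟩, ⟨y, hy, hyx⟩⟩
      have : y ∈ LinearMap.range (LinearMap.codRestrict E i fun x => hE.prop.1 ⟨x, rfl⟩) ⊓ N :=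
        ⟨⟨x, Subtype.ext hyx.symm⟩, hy⟩
      rw [hN] at this
      rw [← hyx, (Submodule.mem_bot _).1 this]
      simp)
    rw [eq_bot_iff]
    intro x hx
    have hx0 : (x : I) ∈ N.map E.subtype := ⟨x, hx, rfl⟩
    rw [this] at hx0
    exact Subtype.ext hx0

/-- The injective envelope `k` of the `R`-module `R / rad R`. -/
noncomputable def dualizing (R : Type u) [CommRing R] : ModuleCat.{u} R :=
  (Classical.choice (InjectiveEnvelope.nonempty R (R ⧸ Ring.jacobson R))).E

/-! ### Minimal projective resolutions and syzygies -/

/-- A submodule `K` of `P` is superfluous if no proper submodule `N` satisfies `K + N = P`. -/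
def IsSuperfluous {Λ P : Type*} [Ring Λ] [AddCommGroup P] [Module Λ P]
    (K : Submodule Λ P) : Prop :=
  ∀ N : Submodule Λ P, K ⊔ N = ⊤ → N = ⊤

/-- A projective resolution by finitely generated modules is minimal if each of the maps
`P₀ → M` and `Pᵢ₊₁ → im (Pᵢ₊₁ → Pᵢ)` is a projective cover, that is, has superfluous kernel. -/
structure IsMinimalResolution {Λ : Type u} [Ring Λ] {M : ModuleCat.{u} Λ}
    (P : ProjectiveResolution M) : Prop where
  finite : ∀ i, Module.Finite Λ (P.complex.X i)
  superfluous_zero : IsSuperfluous (LinearMap.ker (P.π.f 0).hom)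
  superfluous_succ : ∀ i, IsSuperfluous (LinearMap.ker (P.complex.d (i + 1) i).hom)

theorem exists_projectiveCover (Λ : Type u) [Ring Λ] [IsArtinianRing Λ] (M : Type u) [AddCommGroup M]
    [Module Λ M] [Module.Finite Λ M] :
    ∃ (P : ModuleCat.{u} Λ) (p : P →ₗ[Λ] M), Module.Finite Λ P ∧ Module.Projective Λ P ∧
      Function.Surjective p ∧ IsSuperfluous (LinearMap.ker p) := by
  let Q (l : ℕ∞) : Prop := ∃ (P : ModuleCat.{u} Λ) (p : P →ₗ[Λ] M), Module.Finite Λ P ∧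
    Module.Projective Λ P ∧ Function.Surjective p ∧ Module.length Λ P = l
  have hQ : ∃ l, Q l := by
    obtain ⟨n, f, hf⟩ := Module.Finite.exists_fin' Λ M
    exact ⟨_, ModuleCat.of Λ (Fin n → Λ), f, inferInstanceAs (Module.Finite Λ (Fin n → Λ)),
      inferInstanceAs (Module.Projective Λ (Fin n → Λ)), hf, rfl⟩
  obtain ⟨l, ⟨P, p, hfin, hproj, hp, rfl⟩, hmin⟩ :=
    WellFounded.has_min (wellFounded_lt (α := ℕ∞)) {l | Q l} hQ
  refine ⟨P, p, hfin, hproj, hp, fun N hN => ?_⟩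
  have hsurj : Function.Surjective (p ∘ₗ N.subtype) := by
    intro m
    obtain ⟨x, rfl⟩ := hp m
    obtain ⟨a, ha, b, hb, rfl⟩ := Submodule.mem_sup.1 (hN ▸ Submodule.mem_top : x ∈ _)
    exact ⟨⟨b, hb⟩, by simp [LinearMap.mem_ker.1 ha]⟩
  obtain ⟨h, hh⟩ := Module.projective_lifting_property (p ∘ₗ N.subtype) p hsurj
  let g : Module.End Λ P := N.subtype ∘ₗ h
  have hg (x : P) : p (g x) = p x := LinearMap.congr_fun hh x
  have hgk (k : ℕ) (x : P) : p ((g ^ k) x) = p x := by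
    induction k with
    | zero => simp
    | succ k ih => rw [pow_succ', Module.End.mul_apply, hg, ih]
  obtain ⟨k, hk, hk1⟩ := (g.eventually_isCompl_ker_pow_range_pow.and
    (Filter.eventually_ge_atTop 1)).exists
  let W := LinearMap.range (g ^ k)
  have hW : Module.Projective Λ W :=
    Module.Projective.of_split W.subtype (W.projectionOnto _ hk.symm) (by
      ext x; simp)
  have hWN : W ≤ N := by
    rintro _ ⟨x, rfl⟩
    obtain ⟨j, rfl⟩ := Nat.exists_eq_add_of_le' hk1
    rw [pow_succ', Module.End.mul_apply]
    exact (h _).2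
  have hWtop : W = ⊤ := by
    by_contra hne
    refine hmin (Module.length Λ W) ⟨ModuleCat.of Λ W, p ∘ₗ W.subtype, ?_, hW, ?_, rfl⟩
      (Submodule.length_lt hne)
    · exact inferInstanceAs (Module.Finite Λ W)
    · intro m
      obtain ⟨x, rfl⟩ := hp m
      exact ⟨⟨(g ^ k) x, x, rfl⟩, hgk k x⟩
  exact top_le_iff.1 (hWtop ▸ hWN)

theorem exists_isMinimalResolution (Λ : Type u) [Ring Λ] [IsArtinianRing Λ] (M : ModuleCat.{u} Λ)
    [Module.Finite Λ M] : ∃ P : ProjectiveResolution M, IsMinimalResolution P := by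
  let T := {X : ModuleCat.{u} Λ // Module.Finite Λ X}
  have hcov (X : T) := have := X.2; exists_projectiveCover Λ X.1
  choose P p hfin hproj hsurj hsup using hcov
  have hker (X : T) : Module.Finite Λ (LinearMap.ker (p X)) := by
    have := hfin X
    infer_instance
  let s (X : T) : T := ⟨ModuleCat.of Λ (LinearMap.ker (p X)), hker X⟩
  let X (i : ℕ) : T := Nat.rec ⟨M, inferInstance⟩ (fun _ Y => s Y) i
  let δ (i : ℕ) : P (X (i + 1)) ⟶ P (X i) :=
    ModuleCat.ofHom ((LinearMap.ker (p (X i))).subtype ∘ₗ p (X (i + 1)))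
  let ε : P (X 0) ⟶ M := ModuleCat.ofHom (p (X 0))
  have hrange (i : ℕ) : LinearMap.range (δ i).hom = LinearMap.ker (p (X i)) := by
    change LinearMap.range ((LinearMap.ker (p (X i))).subtype ∘ₗ p (X (i + 1))) = _
    rw [LinearMap.range_comp, LinearMap.range_eq_top.2 (hsurj (X (i + 1))), Submodule.map_top,
      Submodule.range_subtype]
  have hkerδ (i : ℕ) : LinearMap.ker (δ i).hom = LinearMap.ker (p (X (i + 1))) := by
    change LinearMap.ker ((LinearMap.ker (p (X i))).subtype ∘ₗ p (X (i + 1))) = _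
    rw [LinearMap.ker_comp, Submodule.ker_subtype]
    rfl
  have hex (i : ℕ) : LinearMap.range (δ (i + 1)).hom = LinearMap.ker (δ i).hom :=
    (hrange (i + 1)).trans (hkerδ i).symm
  have hδδ (i : ℕ) : δ (i + 1) ≫ δ i = 0 := by
    ext x
    exact (hex i).le ⟨x, rfl⟩
  have hδε : δ 0 ≫ ε = 0 := by
    ext x
    exact (hrange 0).le ⟨x, rfl⟩
  let K : ChainComplex (ModuleCat.{u} Λ) ℕ := ChainComplex.of (fun i => P (X i)) δ hδδ
  have hKd (i : ℕ) : K.d (i + 1) i = δ i := by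
    simp only [K, ChainComplex.of_d]
  let π : K ⟶ (ChainComplex.single₀ _).obj M :=
    (ChainComplex.toSingle₀Equiv K M).symm ⟨ε, by rw [hKd]; exact hδε⟩
  have hπ : π.f 0 = ε := ChainComplex.toSingle₀Equiv_symm_apply_f_zero _ _
  have hq : QuasiIso π := ⟨fun n => by
    cases n with
    | zero =>
      rw [ChainComplex.quasiIsoAt₀_iff, ShortComplex.quasiIso_iff_of_zeros' _ rfl rfl rfl]
      have h1 : (ShortComplex.mk (δ 0) ε hδε).Exact ∧ Epi (ShortComplex.mk (δ 0) ε hδε).g := by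
        refine ⟨ShortComplex.Exact.moduleCat_of_range_eq_ker _ _ (hrange 0), ?_⟩
        exact (ModuleCat.epi_iff_surjective _).2 (hsurj (X 0))
      refine (ShortComplex.exact_and_epi_g_iff_of_iso ?_).2 h1
      exact ShortComplex.isoMk (Iso.refl _) (Iso.refl _) (Iso.refl _)
          (by simp only [Iso.refl_hom]; exact (Category.id_comp _).trans ((hKd 0).symm.trans (Category.comp_id _).symm))
          (by simp only [Iso.refl_hom]; exact (Category.id_comp _).trans (hπ.symm.trans (Category.comp_id _).symm))
    | succ n =>
      rw [quasiIsoAt_iff_exactAt' _ _ (ChainComplex.exactAt_succ_single_obj _ _),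
        HomologicalComplex.exactAt_iff' _ (n + 2) (n + 1) n (by simp) (by simp),
        ShortComplex.moduleCat_exact_iff_range_eq_ker]
      change LinearMap.range (K.d (n + 2) (n + 1)).hom = LinearMap.ker (K.d (n + 1) n).hom
      rw [hKd, hKd]
      exact hex n⟩
  refine ⟨{ complex := K, projective := fun i => ?_, π := π, quasiIso := hq },
    ⟨fun i => hfin (X i), ?_, fun i => ?_⟩⟩
  · exact (IsProjective.iff_projective _).1 (hproj (X i))
  · change IsSuperfluous (LinearMap.ker (π.f 0).hom)
    rw [hπ]
    exact hsup (X 0)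
  · change IsSuperfluous (LinearMap.ker (K.d (i + 1) i).hom)
    rw [hKd, hkerδ]
    exact hsup (X (i + 1))

theorem exists_minimalResolution (R Λ : Type u) [CommRing R] [Ring Λ] [Algebra R Λ]
    [IsArtinAlgebra R Λ] (M : ModuleCat.{u} Λ) [Module.Finite Λ M] :
    ∃ P : ProjectiveResolution M, IsMinimalResolution P :=
  have := IsArtinAlgebra.isArtinianRing R Λ
  exists_isMinimalResolution Λ M

/-- The fixed minimal projective resolution of `M`. Its term of homological degree `i` is
`P⁻ⁱ(M)`. -/
noncomputable def minRes (R Λ : Type u) [CommRing R] [Ring Λ] [Algebra R Λ]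
    [IsArtinAlgebra R Λ] (M : ModuleCat.{u} Λ) [Module.Finite Λ M] :
    ProjectiveResolution M :=
  (exists_minimalResolution R Λ M).choose

theorem isMinimalResolution_minRes (R Λ : Type u) [CommRing R] [Ring Λ] [Algebra R Λ]
    [IsArtinAlgebra R Λ] (M : ModuleCat.{u} Λ) [Module.Finite Λ M] :
    IsMinimalResolution (minRes R Λ M) :=
  (exists_minimalResolution R Λ M).choose_spec

/-- The `i`-th syzygy `Ωⁱ(M)`: the module `M` itself if `i = 0`, the kernel of `P⁰(M) → M` if
`i = 1`, and the kernel of `P⁻ⁱ⁺¹(M) → P⁻ⁱ⁺²(M)` if `i ≥ 2`. -/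
noncomputable def syzygy (R Λ : Type u) [CommRing R] [Ring Λ] [Algebra R Λ]
    [IsArtinAlgebra R Λ] (M : ModuleCat.{u} Λ) [Module.Finite Λ M] :
    ℕ → ModuleCat.{u} Λ
  | 0 => M
  | 1 => ModuleCat.of Λ (LinearMap.ker ((minRes R Λ M).π.f 0).hom)
  | i + 2 => ModuleCat.of Λ (LinearMap.ker ((minRes R Λ M).complex.d (i + 1) i).hom)

instance finite_syzygy (R Λ : Type u) [CommRing R] [Ring Λ] [Algebra R Λ]
    [IsArtinAlgebra R Λ] (M : ModuleCat.{u} Λ) [Module.Finite Λ M] (i : ℕ) :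
    Module.Finite Λ (syzygy R Λ M i) := by
  have := IsArtinAlgebra.isArtinianRing R Λ
  have hP := (isMinimalResolution_minRes R Λ M).finite
  match i with
  | 0 => assumption
  | 1 =>
    have := hP 0
    exact inferInstanceAs (Module.Finite Λ (LinearMap.ker ((minRes R Λ M).π.f 0).hom))
  | i + 2 =>
    have := hP (i + 1)
    exact inferInstanceAs
      (Module.Finite Λ (LinearMap.ker ((minRes R Λ M).complex.d (i + 1) i).hom))

/-! ### The Nakayama functor and the Auslander-Reiten translation -/

section Nakayama

/-- The underlying group of `ν(P) = D(P*) = Hom_R(Hom_Λ(P, Λ), k)`. -/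
def Nakayama (R Λ : Type u) [CommRing R] [Ring Λ] [Algebra R Λ]
    (P : Type u) [AddCommGroup P] [Module Λ P] : Type u :=
  (P →ₗ[Λ] Λ) →ₗ[R] dualizing R

variable {R Λ : Type u} [CommRing R] [Ring Λ] [Algebra R Λ]
variable {P Q : Type u} [AddCommGroup P] [Module Λ P] [AddCommGroup Q] [Module Λ Q]

noncomputable instance : AddCommGroup (Nakayama R Λ P) :=
  inferInstanceAs (AddCommGroup ((P →ₗ[Λ] Λ) →ₗ[R] dualizing R))

/-- Right multiplication by `a` on the right `Λ`-module `P* = Hom_Λ(P, Λ)`: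
`(g · a)(x) = g(x) a`. -/
def dualRightMul (a : Λ) : (P →ₗ[Λ] Λ) →ₗ[R] (P →ₗ[Λ] Λ) where
  toFun g := MulOpposite.op a • g
  map_add' _ _ := smul_add _ _ _
  map_smul' r g := smul_comm (MulOpposite.op a) r g

/-- The left `Λ`-module structure `(a • φ)(g) = φ(g · a)` on `ν(P)`. -/
noncomputable instance : Module Λ (Nakayama R Λ P) where
  smul a φ := LinearMap.comp (show (P →ₗ[Λ] Λ) →ₗ[R] dualizing R from φ) (dualRightMul a)
  one_smul φ := LinearMap.ext fun g => congrArg φ.toFun (one_smul (Λᵐᵒᵖ) g)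
  mul_smul a b φ := LinearMap.ext fun g =>
    congrArg φ.toFun (mul_smul (MulOpposite.op b) (MulOpposite.op a) g)
  smul_zero _ := rfl
  smul_add _ _ _ := rfl
  add_smul a b φ := LinearMap.ext fun g =>
    (congrArg φ.toFun (add_smul (MulOpposite.op a) (MulOpposite.op b) g)).trans (φ.map_add' _ _)
  zero_smul φ := LinearMap.ext fun g =>
    (congrArg φ.toFun (zero_smul (Λᵐᵒᵖ) g)).trans
      (LinearMap.map_zero (show (P →ₗ[Λ] Λ) →ₗ[R] dualizing R from φ))

/-- The map `f* : Q* → P*`, `g ↦ g ∘ f`, induced by `f : P → Q`. -/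
def dualMap (f : P →ₗ[Λ] Q) : (Q →ₗ[Λ] Λ) →ₗ[R] (P →ₗ[Λ] Λ) where
  toFun g := g ∘ₗ f
  map_add' _ _ := rfl
  map_smul' _ _ := rfl

/-- The map `ν(f) : ν(P) → ν(Q)`, `φ ↦ φ ∘ f*`, induced by `f : P → Q`. -/
noncomputable def nakayamaMap (f : P →ₗ[Λ] Q) : Nakayama R Λ P →ₗ[Λ] Nakayama R Λ Q where
  toFun φ := LinearMap.comp (show (P →ₗ[Λ] Λ) →ₗ[R] dualizing R from φ) (dualMap f)
  map_add' _ _ := rfl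
  map_smul' _ _ := rfl

end Nakayama

/-- The Auslander-Reiten translation `τ(M)`, the kernel of `ν(P⁻¹(M)) → ν(P⁰(M))`. -/
noncomputable def tau (R Λ : Type u) [CommRing R] [Ring Λ] [Algebra R Λ]
    [IsArtinAlgebra R Λ] (M : ModuleCat.{u} Λ) [Module.Finite Λ M] :
    ModuleCat.{u} Λ :=
  ModuleCat.of Λ (LinearMap.ker (nakayamaMap (R := R) ((minRes R Λ M).complex.d 1 0).hom))

/-- The `n`-Auslander-Reiten translation `τₙ(M) = τ(Ωⁿ⁻¹(M))`, for `n ≥ 1`. -/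
noncomputable def tauN (R Λ : Type u) [CommRing R] [Ring Λ] [Algebra R Λ]
    [IsArtinAlgebra R Λ] (M : ModuleCat.{u} Λ) [Module.Finite Λ M] (n : ℕ) :
    ModuleCat.{u} Λ :=
  tau R Λ (syzygy R Λ M (n - 1))

/-- The `τₙ`-perpendicular category of `M`: the finitely generated modules `N` such that
`Hom_Λ(N, τₙ(M)) = 0` and `Extⁱ_Λ(M, N) = 0` for `1 ≤ i ≤ n - 1`. -/
def tauPerp (R Λ : Type u) [CommRing R] [Ring Λ] [Algebra R Λ]
    [IsArtinAlgebra R Λ] (M : ModuleCat.{u} Λ) [Module.Finite Λ M] (n : ℕ) :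
    ObjectProperty (ModuleCat.{u} Λ) :=
  fun N => Module.Finite Λ N ∧ (∀ f : N ⟶ tauN R Λ M n, f = 0) ∧
    ∀ i : ℕ, 1 ≤ i → i ≤ n - 1 → Subsingleton (Abelian.Ext.{u} M N i)

/-! ### The class `genₙ(M)` -/

/-- The class `genₙ(M)` of the finitely generated modules `X` for which there is an exact sequence
`Mₙ → Mₙ₋₁ → ⋯ → M₂ → M₁ → X → 0` with `Mᵢ` in `add(M)` for `1 ≤ i ≤ n`. In the definition, `E 0`
is `X` up to isomorphism, `E i` is `Mᵢ` for `1 ≤ i ≤ n`, and the other data are irrelevant. -/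
def gen (Λ : Type u) [Ring Λ] (M : ModuleCat.{u} Λ) (n : ℕ) : ObjectProperty (ModuleCat.{u} Λ) :=
  fun X => Module.Finite Λ X ∧
    ∃ (E : ℕ → ModuleCat.{u} Λ) (d : ∀ i, E (i + 1) ⟶ E i),
      Nonempty (E 0 ≅ X) ∧ (∀ i, 1 ≤ i → i ≤ n → addClosure M (E i)) ∧
      Function.Surjective (d 0).hom ∧
      ∀ i, i + 2 ≤ n → Function.Exact (d (i + 1)).hom (d i).hom

/-! ### The homotopy category `K^b(proj Λ)` -/

section Homotopy

variable (Λ : Type u) [Ring Λ]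

/-- The bounded cochain complexes of finitely generated projective modules. -/
def boundedProj : ObjectProperty (CochainComplex (ModuleCat.{u} Λ) ℤ) := fun K =>
  (∃ a : ℤ, K.IsStrictlyGE a) ∧ (∃ b : ℤ, K.IsStrictlyLE b) ∧
    ∀ i, Module.Finite Λ (K.X i) ∧ Module.Projective Λ (K.X i)

/-- The objects of the homotopy category of cochain complexes of modules which are bounded complexes
of finitely generated projective modules. -/
def homotopyBoundedProj : ObjectProperty (HomotopyCategory (ModuleCat.{u} Λ) (.up ℤ)) :=
  (boundedProj Λ).strictMap (HomotopyCategory.quotient _ _)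

variable {Λ}

theorem homotopyBoundedProj_quotient_obj_iff (K : CochainComplex (ModuleCat.{u} Λ) ℤ) :
    homotopyBoundedProj Λ ((HomotopyCategory.quotient _ _).obj K) ↔ boundedProj Λ K := by
  refine ⟨?_, fun h => ⟨_, h⟩⟩
  simp only [homotopyBoundedProj, ObjectProperty.strictMap_iff]
  rintro ⟨L, h, hL⟩
  obtain rfl : L = K := congr_arg Quotient.as hL
  exact h

theorem boundedProj_mappingCone {K L : CochainComplex (ModuleCat.{u} Λ) ℤ} (f : K ⟶ L)
    (hK : boundedProj Λ K) (hL : boundedProj Λ L) :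
    boundedProj Λ (CochainComplex.mappingCone f) := by
  obtain ⟨⟨a, _⟩, ⟨b, _⟩, hK⟩ := hK
  obtain ⟨⟨a', _⟩, ⟨b', _⟩, hL⟩ := hL
  refine ⟨⟨min (a - 1) a', CochainComplex.isStrictlyGE_mappingCone f a a' _
    (by simp) (by simp)⟩, ⟨max b b', ?_⟩, fun i => ?_⟩
  · rw [CochainComplex.isStrictlyLE_iff]
    intro i hi
    simp only [CochainComplex.mappingCone.isZero_X_iff]
    exact ⟨K.isZero_of_isStrictlyLE b _ (by grind), L.isZero_of_isStrictlyLE b' _ (by grind)⟩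
  · let e : (CochainComplex.mappingCone f).X i ≅ ModuleCat.of Λ (K.X (i + 1) × L.X i) :=
      HomologicalComplex.homotopyCofiber.XIsoBiprod f i (i + 1) rfl ≪≫ ModuleCat.biprodIsoProd _ _
    have := (hK (i + 1)).1
    have := (hK (i + 1)).2
    have := (hL i).1
    have := (hL i).2
    have e' : (K.X (i + 1) × L.X i) ≃ₗ[Λ] (CochainComplex.mappingCone f).X i :=
      e.symm.toLinearEquiv
    exact ⟨Module.Finite.equiv e', Module.Projective.of_equiv e'⟩

instance : (homotopyBoundedProj Λ).ContainsZero where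
  exists_zero :=
    ⟨(HomotopyCategory.quotient _ _).obj 0, Functor.map_isZero _ (isZero_zero _), by
      rw [homotopyBoundedProj_quotient_obj_iff]
      refine ⟨⟨0, inferInstance⟩, ⟨0, inferInstance⟩, fun i => ?_⟩
      have : Subsingleton ((0 : CochainComplex (ModuleCat.{u} Λ) ℤ).X i) :=
        ModuleCat.subsingleton_of_isZero
          (Functor.map_isZero (HomologicalComplex.eval _ _ i) (isZero_zero _))
      exact ⟨inferInstance, inferInstance⟩⟩

instance : (homotopyBoundedProj Λ).IsStableUnderShift ℤ where
  isStableUnderShiftBy n :=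
    { le_shift K hK := by
        obtain ⟨K : CochainComplex _ _, rfl⟩ := K.quotient_obj_surjective
        rw [homotopyBoundedProj_quotient_obj_iff] at hK
        obtain ⟨⟨a, _⟩, ⟨b, _⟩, h⟩ := hK
        rw [ObjectProperty.prop_shift_iff, HomotopyCategory.shift_quotient_obj,
          homotopyBoundedProj_quotient_obj_iff]
        exact ⟨⟨a - n, K.isStrictlyGE_shift a n (a - n) (by lia)⟩,
          ⟨b - n, K.isStrictlyLE_shift b n (b - n) (by lia)⟩, fun i => h (i + n)⟩ }

instance : (homotopyBoundedProj Λ).IsTriangulatedClosed₃ where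
  ext₃' T hT h₁ h₂ := by
    have h₁ : boundedProj Λ T.obj₁.as := by rwa [← homotopyBoundedProj_quotient_obj_iff]
    have h₂ : boundedProj Λ T.obj₂.as := by rwa [← homotopyBoundedProj_quotient_obj_iff]
    obtain ⟨f : T.obj₁.as ⟶ T.obj₂.as, hf⟩ :=
      (HomotopyCategory.quotient _ _).map_surjective T.mor₁
    refine ⟨_, ?_, ⟨Pretriangulated.Triangle.π₃.mapIso (Pretriangulated.isoTriangleOfIso₁₂ T _ hT
      (HomotopyCategory.mappingCone_triangleh_distinguished f) (Iso.refl _) (Iso.refl _) ?_)⟩⟩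
    · exact (homotopyBoundedProj_quotient_obj_iff _).2 (boundedProj_mappingCone f h₁ h₂)
    · exact (Category.comp_id _).trans (hf.symm.trans (Category.id_comp _).symm)

instance : (homotopyBoundedProj Λ).IsTriangulated where
  toIsTriangulatedClosed₂ := .of_isTriangulatedClosed₃

variable (Λ)

/-- The triangulated category `K^b(proj Λ)` of bounded cochain complexes of finitely generated
projective modules up to homotopy, with the shift and the distinguished triangles of the homotopy
category of cochain complexes of modules. -/
abbrev Kb := (homotopyBoundedProj Λ).FullSubcategory

end Homotopy

/-! ### Silting complexes and `τₙ`-tilting modules -/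

/-- `P` is presilting if `Hom(P, P[i]) = 0` in `K^b(proj Λ)` for all `i > 0`. -/
def IsPresilting {Λ : Type u} [Ring Λ] (P : Kb Λ) : Prop :=
  ∀ i : ℤ, 0 < i → ∀ f : P ⟶ P⟦i⟧, f = 0

/-- `P` is silting if it is presilting and `K^b(proj Λ)` is the smallest (full, closed under
isomorphisms) triangulated subcategory of `K^b(proj Λ)` which contains `add(P)`. -/
def IsSilting {Λ : Type u} [Ring Λ] (P : Kb Λ) : Prop :=
  IsPresilting P ∧
    ∀ S : ObjectProperty (Kb Λ), S.IsClosedUnderIsomorphisms → S.IsTriangulated →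
      addClosure P ≤ S → S = ⊤

/-- The complex `P^•_{≥ -n}(M)`, which agrees with the minimal projective resolution `P^•(M)` in the
degrees `≥ -n` and vanishes in the degrees `< -n`. -/
noncomputable def truncRes (R Λ : Type u) [CommRing R] [Ring Λ] [Algebra R Λ]
    [IsArtinAlgebra R Λ] (M : ModuleCat.{u} Λ) [Module.Finite Λ M] (n : ℕ) :
    CochainComplex (ModuleCat.{u} Λ) ℤ :=
  (minRes R Λ M).cochainComplex.stupidTrunc (ComplexShape.embeddingUpIntGE (-n))

theorem boundedProj_truncRes (R Λ : Type u) [CommRing R] [Ring Λ] [Algebra R Λ]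
    [IsArtinAlgebra R Λ] (M : ModuleCat.{u} Λ) [Module.Finite Λ M] (n : ℕ) :
    boundedProj Λ (truncRes R Λ M n) := by
  have hzero {X : ModuleCat.{u} Λ} (hX : IsZero X) :
      Module.Finite Λ X ∧ Module.Projective Λ X := by
    have := ModuleCat.subsingleton_of_isZero hX
    exact ⟨inferInstance, Module.Projective.of_free⟩
  have hterm (k : ℕ) {X : ModuleCat.{u} Λ} (e : (minRes R Λ M).complex.X k ≅ X) :
      Module.Finite Λ X ∧ Module.Projective Λ X := by
    have := (isMinimalResolution_minRes R Λ M).finite k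
    have := ModuleCat.projective_of_module_projective ((minRes R Λ M).complex.X k)
    exact ⟨Module.Finite.equiv e.toLinearEquiv, Module.Projective.of_equiv e.toLinearEquiv⟩
  refine ⟨⟨-n, by dsimp only [truncRes]; infer_instance⟩,
    ⟨0, by dsimp only [truncRes]; infer_instance⟩, fun i => ?_⟩
  by_cases hi : i < -n
  · exact hzero (HomologicalComplex.isZero_stupidTrunc_X _ _ i
      (fun j => by simp only [ComplexShape.embeddingUpIntGE_f]; lia))
  · have e : (truncRes R Λ M n).X i ≅ (minRes R Λ M).cochainComplex.X i :=
      HomologicalComplex.stupidTruncXIso _ _ (i := (i + n).toNat) (by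
        simp only [ComplexShape.embeddingUpIntGE_f]; lia)
    by_cases hi' : 0 < i
    · exact hzero (((minRes R Λ M).cochainComplex.isZero_of_isStrictlyLE 0 i).of_iso e)
    · exact hterm (-i).toNat
        (((minRes R Λ M).cochainComplexXIso i (-i).toNat (by lia)).symm ≪≫ e.symm)

/-- The complex `P^•_{≥ -n}(M)` as an object of `K^b(proj Λ)`. -/
noncomputable def truncKb (R Λ : Type u) [CommRing R] [Ring Λ] [Algebra R Λ]
    [IsArtinAlgebra R Λ] (M : ModuleCat.{u} Λ) [Module.Finite Λ M] (n : ℕ) :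
    Kb Λ :=
  ⟨(HomotopyCategory.quotient _ _).obj (truncRes R Λ M n),
    (homotopyBoundedProj_quotient_obj_iff _).2 (boundedProj_truncRes R Λ M n)⟩

/-- `M` is `τₙ`-tilting if `P^•_{≥ -n}(M)` is silting in `K^b(proj Λ)`. -/
def IsTauTilting (R Λ : Type u) [CommRing R] [Ring Λ] [Algebra R Λ]
    [IsArtinAlgebra R Λ] (M : ModuleCat.{u} Λ) [Module.Finite Λ M] (n : ℕ) :
    Prop :=
  IsSilting (truncKb R Λ M n)

end TauTilting

/-! Write P for the minimal resolution of M and T for its truncation to degrees ≥ -n. The pivot is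
the class 𝒳 of finitely generated N for which the complex Hom(T, N) is exact in all positive degrees
(`HomExact` with j = 0). Its exactness in a degree i < n says Ext^i(M, N) = 0. In the top degree n
it says that Hom(P^{-(n-1)}, N) → Hom(P^{-n}, N) is onto, and the duality between Hom(N, ν(Q)) and
Hom(Q, N), for Q finitely generated projective, turns this into Hom(N, τ_n M) = 0. Hence the
τ_n-perpendicular category is 𝒳 (`tauPerp_iff`), and it remains to compare 𝒳 with gen_n(M).

That T is presilting puts M in 𝒳: a cocycle with values in M lifts to a chain map T → T[i], and a
null homotopy of the lift, followed by the augmentation, writes the cocycle as a coboundary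
(`homExact_of_cocycles_mem_coboundaries`). Dimension shifting along an exact sequence with n terms
in add(M) then gives gen_n(M) ⊆ 𝒳 (`homExact_of_gen`).

Conversely, let N be in 𝒳. If M generates N, then N has a surjective right add(M)-approximation,
whose kernel is again in 𝒳 (`HomExact.left`); iterating yields the sequence required by gen_n
(`gen_of_homExact`). To see that M generates N, regard x in N as a map Λ → N. Since T generates
K^b(proj Λ), there is a uniform bound beyond which maps to shifts of Λ vanish, and a descending
induction with left add(T)-approximations factors Λ → N through a sum of copies of T
(`exists_factorization_of_vanishesAbove`). A chain map T → N factors on degree 0 through H^0(T) = M,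
so x lies in the sum of the images of maps M → N (`exists_sum_eq_of_isSilting`). -/

namespace TauTilting

/-! ### Exactness of the truncated Hom complex, and dimension shifting -/

section HomExact

variable {Λ : Type u} [Ring Λ]

/-- Exactness of `Hom(C, N)`, for the truncation of `C` to the degrees `≤ n`, in the degrees `i + 1`
with `j ≤ i` and `i + 1 ≤ n`. -/
def HomExact (C : ChainComplex (ModuleCat.{u} Λ) ℕ) (n : ℕ) (N : ModuleCat.{u} Λ) (j : ℕ) : Prop :=
  ∀ i, j ≤ i → i + 1 ≤ n → ∀ φ : C.X (i + 1) ⟶ N,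
    (i + 1 < n → C.d (i + 2) (i + 1) ≫ φ = 0) → ∃ ψ : C.X i ⟶ N, C.d (i + 1) i ≫ ψ = φ

/-- The identity of `E` is a finite sum of endomorphisms which factor through `A`. -/
def IsSummandOfCopies {D : Type*} [Category D] [Preadditive D] (A E : D) : Prop :=
  ∃ (k : ℕ) (a : Fin k → (E ⟶ A)) (b : Fin k → (A ⟶ E)), ∑ j, a j ≫ b j = 𝟙 E

theorem addClosure.isSummandOfCopies {D : Type*} [Category D] [Preadditive D]
    [HasBinaryBiproducts D] [HasFiniteBiproducts D] {A E : D} (h : addClosure A E) :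
    IsSummandOfCopies A E := by
  obtain ⟨Y, k, ⟨e⟩⟩ := h
  refine ⟨k, fun j => biprod.inl ≫ e.hom ≫ biproduct.π _ j,
    fun j => biproduct.ι (fun _ : Fin k => A) j ≫ e.inv ≫ biprod.fst, ?_⟩
  have : ∑ j : Fin k, (biprod.inl ≫ e.hom ≫ biproduct.π _ j) ≫
      biproduct.ι (fun _ : Fin k => A) j ≫ e.inv ≫ biprod.fst =
      (biprod.inl ≫ e.hom) ≫ (∑ j : Fin k, biproduct.π _ j ≫
        biproduct.ι (fun _ : Fin k => A) j) ≫ e.inv ≫ (biprod.fst : E ⊞ Y ⟶ E) := by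
    simp only [Preadditive.comp_sum, Preadditive.sum_comp, Category.assoc]
  rw [this, biproduct.total]
  simp

theorem HomExact.of_isSummandOfCopies {C : ChainComplex (ModuleCat.{u} Λ) ℕ} {n j : ℕ}
    {A E : ModuleCat.{u} Λ} (hA : HomExact C n A j) (h : IsSummandOfCopies A E) :
    HomExact C n E j := by
  obtain ⟨k, a, b, hab⟩ := h
  intro i hj hi φ hφ
  have H (l : Fin k) : ∃ ψ : C.X i ⟶ A, C.d (i + 1) i ≫ ψ = φ ≫ a l :=
    hA i hj hi (φ ≫ a l) fun h => by rw [← Category.assoc, hφ h, zero_comp]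
  choose ψ hψ using H
  refine ⟨∑ l, ψ l ≫ b l, ?_⟩
  rw [Preadditive.comp_sum]
  simp_rw [← Category.assoc, hψ, Category.assoc]
  rw [← Preadditive.comp_sum, hab, Category.comp_id]

theorem HomExact.of_iso {C : ChainComplex (ModuleCat.{u} Λ) ℕ} {n j : ℕ}
    {A E : ModuleCat.{u} Λ} (hA : HomExact C n A j) (e : A ≅ E) : HomExact C n E j :=
  hA.of_isSummandOfCopies ⟨1, fun _ => e.inv, fun _ => e.hom, by simp⟩

theorem exists_lift_of_exact {K E N Q : ModuleCat.{u} Λ} {ι : K ⟶ E} {p : E ⟶ N}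
    (hex : Function.Exact ι.hom p.hom) (hι : Function.Injective ι.hom) (f : Q ⟶ E)
    (hf : f ≫ p = 0) : ∃ g : Q ⟶ K, g ≫ ι = f := by
  have hf' (x : Q) : f.hom x ∈ LinearMap.range ι.hom :=
    (hex _).1 (by rw [← ModuleCat.comp_apply, hf]; rfl)
  refine ⟨ModuleCat.ofHom ((LinearEquiv.ofInjective ι.hom hι).symm.toLinearMap ∘ₗ
    f.hom.codRestrict _ hf'), ?_⟩
  ext x
  change ι.hom ((LinearEquiv.ofInjective ι.hom hι).symm ⟨f.hom x, hf' x⟩) = f.hom x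
  exact congrArg Subtype.val ((LinearEquiv.ofInjective ι.hom hι).apply_symm_apply ⟨f.hom x, hf' x⟩)

theorem exists_lift_of_surjective {E N Q : ModuleCat.{u} Λ} [Projective Q] {p : E ⟶ N}
    (hp : Function.Surjective p.hom) (f : Q ⟶ N) : ∃ g : Q ⟶ E, g ≫ p = f := by
  have : Epi p := (ModuleCat.epi_iff_surjective _).2 hp
  exact ⟨Projective.factorThru f p, Projective.factorThru_comp f p⟩

theorem comp_eq_zero_of_exact {K E N : ModuleCat.{u} Λ} {ι : K ⟶ E} {p : E ⟶ N}
    (hex : Function.Exact ι.hom p.hom) : ι ≫ p = 0 := by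
  ext x
  exact (hex _).2 ⟨x, rfl⟩

theorem cancel_injective {K E Q : ModuleCat.{u} Λ} {ι : K ⟶ E} (hι : Function.Injective ι.hom)
    {f g : Q ⟶ K} (h : f ≫ ι = g ≫ ι) : f = g := by
  have : Mono ι := (ModuleCat.mono_iff_injective _).2 hι
  exact (cancel_mono ι).1 h

/-- A cocycle in N lifts to E because C is projective, but the lift is a cocycle only up to a map
into K. Exactness for K one degree higher corrects it, which is why K is needed only from j + 1 on.
In the top degree there is no cocycle condition and nothing to correct. -/
theorem HomExact.right {C : ChainComplex (ModuleCat.{u} Λ) ℕ} [∀ i, Projective (C.X i)] {n j : ℕ}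
    {K E N : ModuleCat.{u} Λ} {ι : K ⟶ E} {p : E ⟶ N} (hι : Function.Injective ι.hom)
    (hp : Function.Surjective p.hom) (hex : Function.Exact ι.hom p.hom)
    (hE : HomExact C n E j) (hK : HomExact C n K (j + 1)) : HomExact C n N j := by
  intro i hj hi φ hφ
  obtain ⟨φ', rfl⟩ := exists_lift_of_surjective hp φ
  obtain ⟨κ, hκ⟩ : ∃ κ : C.X (i + 1) ⟶ K,
      i + 1 < n → C.d (i + 2) (i + 1) ≫ κ ≫ ι = C.d (i + 2) (i + 1) ≫ φ' := by
    by_cases h : i + 1 < n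
    · obtain ⟨g, hg⟩ := exists_lift_of_exact hex hι (C.d (i + 2) (i + 1) ≫ φ') (by simpa using hφ h)
      obtain ⟨κ, hκ⟩ := hK (i + 1) (by lia) (by lia) g fun _ => cancel_injective hι (by simp [hg])
      exact ⟨κ, fun _ => by rw [← hg, ← hκ, Category.assoc]⟩
    · exact ⟨0, fun h' => (h h').elim⟩
  obtain ⟨ψ, hψ⟩ := hE i hj hi (φ' - κ ≫ ι) fun h => by
    rw [Preadditive.comp_sub, hκ h, sub_self]
  refine ⟨ψ ≫ p, ?_⟩
  rw [← Category.assoc, hψ, Preadditive.sub_comp, Category.assoc, comp_eq_zero_of_exact hex,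
    comp_zero, sub_zero]

/-- The augmentation `P₀ → M` of a projective resolution. -/
noncomputable def augmentation {M : ModuleCat.{u} Λ} (P : ProjectiveResolution M) :
    P.complex.X 0 ⟶ M :=
  P.π.f 0

theorem augmentation_surjective {M : ModuleCat.{u} Λ} (P : ProjectiveResolution M) :
    Function.Surjective (augmentation P).hom :=
  (ModuleCat.epi_iff_surjective _).1 (inferInstanceAs (Epi (P.π.f 0)))

theorem d_comp_augmentation {M : ModuleCat.{u} Λ} (P : ProjectiveResolution M) :
    P.complex.d 1 0 ≫ augmentation P = 0 :=
  P.complex_d_comp_π_f_zero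

theorem exact_augmentation {M : ModuleCat.{u} Λ} (P : ProjectiveResolution M) :
    Function.Exact (P.complex.d 1 0).hom (augmentation P).hom :=
  (ShortComplex.ShortExact.moduleCat_exact_iff_function_exact _).1 P.exact₀

theorem exact_d {M : ModuleCat.{u} Λ} (P : ProjectiveResolution M) (i : ℕ) :
    Function.Exact (P.complex.d (i + 2) (i + 1)).hom (P.complex.d (i + 1) i).hom :=
  (ShortComplex.ShortExact.moduleCat_exact_iff_function_exact _).1 (P.exact_succ i)

theorem exists_augmentation_comp {M N : ModuleCat.{u} Λ} (P : ProjectiveResolution M)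
    (f : P.complex.X 0 ⟶ N) (hf : P.complex.d 1 0 ≫ f = 0) :
    ∃ g : M ⟶ N, augmentation P ≫ g = f :=
  ⟨P.exact₀.desc f hf, P.exact₀.g_desc _ _⟩

/-- A cocycle in K becomes d ≫ ψ in E, and ψ ≫ p is then a cocycle in N. Subtracting from ψ a
cocycle χ of E over ψ ≫ p brings it into K. For i > 0 such a χ comes from exactness for N and
projectivity; for i = 0, ψ ≫ p is a map M → N on the augmentation, and this is where the
approximation property `hM` enters. -/
theorem HomExact.left {M : ModuleCat.{u} Λ} (P : ProjectiveResolution M) {n : ℕ}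
    {K E N : ModuleCat.{u} Λ} {ι : K ⟶ E} {p : E ⟶ N} (hι : Function.Injective ι.hom)
    (hp : Function.Surjective p.hom) (hex : Function.Exact ι.hom p.hom)
    (hM : ∀ f : M ⟶ N, ∃ g : M ⟶ E, g ≫ p = f)
    (hE : HomExact P.complex n E 0) (hN : HomExact P.complex n N 0) :
    HomExact P.complex n K 0 := by
  intro i _ hi φ hφ
  obtain ⟨ψ, hψ⟩ := hE i (by lia) hi (φ ≫ ι) fun h => by rw [← Category.assoc, hφ h, zero_comp]
  have hψp : P.complex.d (i + 1) i ≫ ψ ≫ p = 0 := by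
    rw [← Category.assoc, hψ, Category.assoc, comp_eq_zero_of_exact hex, comp_zero]
  obtain ⟨χ, hχ, hχd⟩ : ∃ χ : P.complex.X i ⟶ E, χ ≫ p = ψ ≫ p ∧
      P.complex.d (i + 1) i ≫ χ = 0 := by
    cases i with
    | zero =>
      obtain ⟨f, hf⟩ := exists_augmentation_comp P (ψ ≫ p) hψp
      obtain ⟨g, rfl⟩ := hM f
      exact ⟨augmentation P ≫ g, by simpa using hf, by
        rw [← Category.assoc, d_comp_augmentation, zero_comp]⟩
    | succ i =>
      obtain ⟨θ, hθ⟩ := hN i (by lia) (by lia) (ψ ≫ p) fun _ => hψp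
      obtain ⟨θ', rfl⟩ := exists_lift_of_surjective hp θ
      exact ⟨P.complex.d (i + 1) i ≫ θ', by rw [Category.assoc, hθ], by simp⟩
  obtain ⟨κ, hκ⟩ := exists_lift_of_exact hex hι (ψ - χ) (by rw [Preadditive.sub_comp, hχ, sub_self])
  refine ⟨κ, cancel_injective hι ?_⟩
  rw [Category.assoc, hκ, Preadditive.comp_sub, hψ, hχd, sub_zero]

/-- Apply `HomExact.right` to 0 → ker d_l → E_{l+1} → im d_l → 0 with ker d_l = im d_{l+1}. Each
step to the left costs one degree, so at l = n nothing is left to prove. This is why n terms suffice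
and why the kernel of the leftmost map is irrelevant. -/
theorem homExact_of_gen {C : ChainComplex (ModuleCat.{u} Λ) ℕ} [∀ i, Projective (C.X i)] {n : ℕ}
    {M X : ModuleCat.{u} Λ} (hM : HomExact C n M 0) (hX : gen Λ M n X) :
    HomExact C n X 0 := by
  obtain ⟨-, E, d, ⟨e⟩, hE, h0, hex⟩ := hX
  -- `m` bounds the number n - l of remaining steps, so this is a descending induction on l.
  have H (m : ℕ) : ∀ l, n ≤ l + m → HomExact C n (ModuleCat.of Λ (LinearMap.range (d l).hom)) l := by
    induction m with
    | zero => exact fun l hl i _ _ => by lia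
    | succ m ih =>
      intro l hl
      by_cases hln : n ≤ l
      · exact fun i _ _ => by lia
      · refine HomExact.right (K := ModuleCat.of Λ (LinearMap.ker (d l).hom))
          (ι := ModuleCat.ofHom (LinearMap.ker (d l).hom).subtype)
          (p := ModuleCat.ofHom (d l).hom.rangeRestrict) Subtype.val_injective
          (LinearMap.surjective_rangeRestrict _) ?_
          (fun i _ hi => (hM.of_isSummandOfCopies
            (hE (l + 1) (by lia) (by lia)).isSummandOfCopies) i (by lia) hi) ?_
        · intro x
          constructor
          · intro hx
            exact ⟨⟨x, congrArg Subtype.val hx⟩, rfl⟩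
          · rintro ⟨y, rfl⟩
            exact Subtype.ext y.2
        · by_cases hl2 : l + 2 ≤ n
          · have := ih (l + 1) (by lia)
            rwa [← LinearMap.exact_iff.1 (hex l hl2)] at this
          · exact fun i _ _ => by lia
  have := H n 0 (by lia)
  rw [LinearMap.range_eq_top.2 h0] at this
  exact this.of_iso ((Submodule.topEquiv (R := Λ) (M := E 0)).toModuleIso ≪≫ e)

end HomExact

/-! ### Right approximations by powers of M and the construction of the gen_n sequence -/

section Approximation

variable {R Λ : Type u} [CommRing R] [Ring Λ] [Algebra R Λ]

open scoped ModuleCat.Algebra in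
theorem finite_hom [IsArtinAlgebra R Λ] (M N : ModuleCat.{u} Λ) [Module.Finite Λ M]
    [Module.Finite Λ N] : Module.Finite R (M ⟶ N) := by
  have := IsArtinAlgebra.isArtinianRing_base (R := R) (Λ := Λ)
  have := IsArtinAlgebra.finite (R := R) (Λ := Λ)
  have : Module.Finite R M := Module.Finite.trans Λ M
  have : Module.Finite R N := Module.Finite.trans Λ N
  let f : (M ⟶ N) →ₗ[R] (M →ₗ[R] N) :=
    { toFun := fun g => g.hom.restrictScalars R
      map_add' := fun _ _ => rfl
      map_smul' := fun _ _ => rfl }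
  exact Module.Finite.of_injective f fun g h hgh =>
    ModuleCat.hom_ext (LinearMap.restrictScalars_injective R hgh)

theorem exists_generators {R : Type*} [CommRing R] {D : Type*} [Category D] [Preadditive D]
    [Linear R D] (X Y : D) [Module.Finite R (X ⟶ Y)] :
    ∃ (k : ℕ) (g : Fin k → (X ⟶ Y)), ∀ f : X ⟶ Y, ∃ r : Fin k → R, ∑ j, r j • g j = f := by
  obtain ⟨k, g, hg⟩ := Module.Finite.exists_fin (R := R) (M := X ⟶ Y)
  refine ⟨k, g, fun f => ?_⟩
  have : f ∈ Submodule.span R (Set.range g) := hg ▸ Submodule.mem_top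
  exact (Submodule.mem_span_range_iff_exists_fun R).1 this

theorem addClosure_pi (M : ModuleCat.{u} Λ) (k : ℕ) :
    addClosure M (ModuleCat.of Λ (Fin k → M)) :=
  ⟨0, k, ⟨(isoBiprodZero (isZero_zero _)).symm ≪≫
    (ModuleCat.biproductIsoPi (fun _ : Fin k => M)).symm⟩⟩

/-- A module which is the sum of the images of the maps from `M` has a surjective right
approximation by a finite power of `M`. -/
theorem exists_approximation [IsArtinAlgebra R Λ] (M N : ModuleCat.{u} Λ) [Module.Finite Λ M]
    [Module.Finite Λ N]
    (hN : ∀ x : N, ∃ (k : ℕ) (g : Fin k → (M ⟶ N)) (m : Fin k → M), ∑ j, (g j).hom (m j) = x) :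
    ∃ (k : ℕ) (p : ModuleCat.of Λ (Fin k → M) ⟶ N), Function.Surjective p.hom ∧
      ∀ f : M ⟶ N, ∃ g : M ⟶ ModuleCat.of Λ (Fin k → M), g ≫ p = f := by
  let _ : Linear R (ModuleCat.{u} Λ) := ModuleCat.Algebra.instLinear
  have : Module.Finite R (M ⟶ N) := finite_hom M N
  obtain ⟨k, g, hg⟩ := exists_generators (R := R) M N
  let p : ModuleCat.of Λ (Fin k → M) ⟶ N :=
    ModuleCat.ofHom (∑ j, (g j).hom ∘ₗ LinearMap.proj j)
  have hp (v : Fin k → M) : p.hom v = ∑ j, (g j).hom (v j) := by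
    simp [p]
  have hlift (f : M ⟶ N) : ∃ h : M ⟶ ModuleCat.of Λ (Fin k → M), h ≫ p = f := by
    obtain ⟨r, rfl⟩ := hg f
    -- The scalars are absorbed into endomorphisms of M: Σ r_j g_j = Σ (r_j · 1) ≫ g_j. So R-module
    -- generators of Hom(M, N) already give an approximation.
    refine ⟨ModuleCat.ofHom (LinearMap.pi fun j => (r j • 𝟙 M : M ⟶ M).hom), ?_⟩
    ext x
    change p.hom _ = _
    rw [hp]
    have : ∑ j, r j • g j = ∑ j, (r j • 𝟙 M : M ⟶ M) ≫ g j := by simp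
    rw [this, ModuleCat.hom_sum, LinearMap.sum_apply]
    rfl
  refine ⟨k, p, fun x => ?_, hlift⟩
  obtain ⟨l, f, m, rfl⟩ := hN x
  choose h hh using hlift
  refine ⟨∑ j, (h (f j)).hom (m j), ?_⟩
  rw [map_sum]
  refine Finset.sum_congr rfl fun j _ => ?_
  conv_rhs => rw [← hh (f j)]
  rfl

/-- The pairs of conditions "finitely generated" and `HomExact` survive passage to the kernel of an
approximation M^k → N, so approximating can be repeated indefinitely; splicing gives an exact
sequence of any length. `T` packages the class so that the recursion stays inside it. -/
theorem gen_of_homExact [IsArtinAlgebra R Λ] {M : ModuleCat.{u} Λ} [Module.Finite Λ M]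
    (P : ProjectiveResolution M) (n : ℕ) (hM : HomExact P.complex n M 0)
    (hP : ∀ N : ModuleCat.{u} Λ, HomExact P.complex n N 0 → ∀ x : N,
      ∃ (k : ℕ) (g : Fin k → (M ⟶ N)) (m : Fin k → M), ∑ j, (g j).hom (m j) = x)
    {N : ModuleCat.{u} Λ} [Module.Finite Λ N] (hN : HomExact P.complex n N 0) : gen Λ M n N := by
  have := IsArtinAlgebra.isArtinianRing R Λ
  let T := {X : ModuleCat.{u} Λ // Module.Finite Λ X ∧ HomExact P.complex n X 0}
  have happ (X : T) := have := X.2.1; exists_approximation (R := R) M X.1 (hP X.1 X.2.2)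
  choose k p hsurj hlift using happ
  have hker (X : T) : Module.Finite Λ (LinearMap.ker (p X).hom) := by
    have : Module.Finite Λ (ModuleCat.of Λ (Fin (k X) → M)) :=
      inferInstanceAs (Module.Finite Λ (Fin (k X) → M))
    infer_instance
  let s (X : T) : T := ⟨ModuleCat.of Λ (LinearMap.ker (p X).hom), hker X,
    HomExact.left P (ι := ModuleCat.ofHom (LinearMap.ker (p X).hom).subtype)
      Subtype.val_injective (hsurj X)
      (LinearMap.exact_subtype_ker_map (p X).hom) (hlift X)
      (hM.of_isSummandOfCopies (addClosure_pi M _).isSummandOfCopies) X.2.2⟩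
  let X (i : ℕ) : T := Nat.rec ⟨N, inferInstance, hN⟩ (fun _ Y => s Y) i
  -- Index shift: E 0 is N itself, and E (i + 1) is the power of M approximating the i-th kernel X
  -- i, with X 0 = N.
  let E : ℕ → ModuleCat.{u} Λ := fun i => Nat.casesOn (motive := fun _ => ModuleCat.{u} Λ) i N fun i => ModuleCat.of Λ (Fin (k (X i)) → M)
  let d : ∀ i, E (i + 1) ⟶ E i := fun i => Nat.casesOn (motive := fun i => E (i + 1) ⟶ E i) i (p (X 0)) fun i =>
    ModuleCat.ofHom ((LinearMap.ker (p (X i)).hom).subtype ∘ₗ (p (X (i + 1))).hom)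
  have hkerd (i : ℕ) : LinearMap.ker (d i).hom = LinearMap.ker (p (X i)).hom := by
    cases i with
    | zero => rfl
    | succ i =>
      change LinearMap.ker ((LinearMap.ker (p (X i)).hom).subtype ∘ₗ (p (X (i + 1))).hom) = _
      rw [LinearMap.ker_comp, Submodule.ker_subtype]
      rfl
  refine ⟨inferInstance, E, d, ⟨Iso.refl _⟩, fun i hi _ => ?_, hsurj (X 0), fun i _ => ?_⟩
  · obtain ⟨i, rfl⟩ := Nat.exists_eq_add_of_le' hi
    exact addClosure_pi M _
  · rw [LinearMap.exact_iff, hkerd]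
    change _ = LinearMap.range ((LinearMap.ker (p (X i)).hom).subtype ∘ₗ (p (X (i + 1))).hom)
    rw [LinearMap.range_comp, LinearMap.range_eq_top.2 (hsurj (X (i + 1))), Submodule.map_top,
      Submodule.range_subtype]

end Approximation

/-! ### Factoring maps through add(P) in a triangulated category -/

section Triangulated

open Pretriangulated

variable {D : Type*} [Category D] [Preadditive D] [HasShift D ℤ]

/-- There are no nonzero maps from `X` to the positive shifts of `Y`. -/
def VanishesAbove (X Y : D) : Prop :=
  ∀ i : ℤ, 0 < i → ∀ f : X ⟶ Y⟦i⟧, f = 0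

/-- The objects `L` such that there is a bound `m` such that `Hom(Y, L[i]) = 0` for `i ≥ m` and for
all `Y` in `𝒬` which have no nonzero maps to the positive shifts of `P`. -/
def eventuallyVanishing (𝒬 : ObjectProperty D) (P : D) : ObjectProperty D := fun L =>
  ∃ m : ℤ, ∀ Y, 𝒬 Y → VanishesAbove Y P → ∀ i, m ≤ i → ∀ f : Y ⟶ L⟦i⟧, f = 0

theorem IsSummandOfCopies.eq_zero_of_target {D : Type*} [Category D] [Preadditive D]
    {A E Y : D} (h : IsSummandOfCopies A E) (hA : ∀ f : Y ⟶ A, f = 0) (f : Y ⟶ E) : f = 0 := by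
  obtain ⟨k, a, b, hab⟩ := h
  rw [← Category.comp_id f, ← hab, Preadditive.comp_sum]
  exact Finset.sum_eq_zero fun j _ => by rw [← Category.assoc, hA (f ≫ a j), zero_comp]

theorem IsSummandOfCopies.eq_zero_of_source {D : Type*} [Category D] [Preadditive D]
    {A E Y : D} (h : IsSummandOfCopies A E) (hA : ∀ f : A ⟶ Y, f = 0) (f : E ⟶ Y) : f = 0 := by
  obtain ⟨k, a, b, hab⟩ := h
  rw [← Category.id_comp f, ← hab, Preadditive.sum_comp]
  exact Finset.sum_eq_zero fun j _ => by rw [Category.assoc, hA (b j ≫ f), comp_zero]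

theorem IsSummandOfCopies.map {D D' : Type*} [Category D] [Preadditive D] [Category D']
    [Preadditive D'] (F : D ⥤ D') [F.Additive] {A E : D} (h : IsSummandOfCopies A E) :
    IsSummandOfCopies (F.obj A) (F.obj E) := by
  obtain ⟨k, a, b, hab⟩ := h
  exact ⟨k, fun j => F.map (a j), fun j => F.map (b j), by
    simp_rw [← F.map_comp]
    rw [← F.map_sum, hab, F.map_id]⟩

theorem IsSummandOfCopies.prop_eventuallyVanishing
    [∀ n : ℤ, (shiftFunctor D n).Additive] (𝒬 : ObjectProperty D) {P E : D}
    (h : IsSummandOfCopies P E) : eventuallyVanishing 𝒬 P E :=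
  ⟨1, fun _ _ hYP i hi f => (h.map (shiftFunctor D i)).eq_zero_of_target (hYP i (by lia)) f⟩

variable [HasZeroObject D] [∀ n : ℤ, (shiftFunctor D n).Additive] [Pretriangulated D]

instance (𝒬 : ObjectProperty D) (P : D) : (eventuallyVanishing 𝒬 P).IsClosedUnderIsomorphisms where
  of_iso e h := by
    obtain ⟨m, hm⟩ := h
    refine ⟨m, fun Y hY hYP i hi f => ?_⟩
    rw [← cancel_mono (e.inv⟦i⟧'), hm Y hY hYP i hi (f ≫ e.inv⟦i⟧'), zero_comp]

/-- A shift moves the bound and an extension takes the maximum of two bounds. The bound must not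
depend on Y, because the later induction replaces Y by successive cones. -/
instance (𝒬 : ObjectProperty D) (P : D) : (eventuallyVanishing 𝒬 P).IsTriangulated where
  exists_zero := ⟨0, isZero_zero D, 0, fun Y _ _ i _ f =>
    ((shiftFunctor D i).map_isZero (isZero_zero D)).eq_of_tgt _ _⟩
  isStableUnderShiftBy n :=
    { le_shift := by
        rintro L ⟨m, hm⟩
        refine ⟨m - n, fun Y hY hYP i hi f => ?_⟩
        rw [← cancel_mono ((shiftFunctorAdd D n i).inv.app L), zero_comp]
        exact hm Y hY hYP (n + i) (by lia) _ }
  toIsTriangulatedClosed₂ := .mk' (by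
    rintro T hT ⟨m, hm⟩ ⟨m', hm'⟩
    refine ⟨max m m', fun Y hY hYP i hi f => ?_⟩
    obtain ⟨g, hg⟩ := Triangle.coyoneda_exact₂ _ (Triangle.shift_distinguished T hT i) f
      (hm' Y hY hYP i (by lia) _)
    rw [hg, hm Y hY hYP i (by lia) g]
    exact zero_comp)

/-- This is the long exact sequence of Hom(-, W), with the obstruction stated after one shift so
that no shift by -1 appears. The sign of `-q` cancels the one introduced by rotating the triangle.
-/
theorem exists_comp_eq_of_shift {X Y Z W : D} {f : X ⟶ Y} {g : Y ⟶ Z} {δ : Z ⟶ X⟦(1 : ℤ)⟧}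
    (hT : Triangle.mk f g δ ∈ distTriang D) (u : X ⟶ W) (hu : δ ≫ u⟦(1 : ℤ)⟧' = 0) :
    ∃ q : Y ⟶ W, f ≫ q = u := by
  obtain ⟨q', hq⟩ : ∃ q' : Y⟦(1 : ℤ)⟧ ⟶ W⟦(1 : ℤ)⟧, u⟦(1 : ℤ)⟧' = (-f⟦(1 : ℤ)⟧') ≫ q' :=
    Triangle.yoneda_exact₃ _ (rot_of_distTriang _ hT) (u⟦(1 : ℤ)⟧') hu
  obtain ⟨q, rfl⟩ := (shiftFunctor D (1 : ℤ)).map_surjective q'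
  refine ⟨-q, (shiftFunctor D (1 : ℤ)).map_injective ?_⟩
  rw [hq]
  simp

/-- Left approximations of the objects of `𝒬` by sums of copies of `P`. -/
def HasLeftApproximations (𝒬 : ObjectProperty D) (P : D) : Prop :=
  ∀ Y, 𝒬 Y → ∃ Q, 𝒬 Q ∧ IsSummandOfCopies P Q ∧ ∃ f : Y ⟶ Q, ∀ g : Y ⟶ P, ∃ h : Q ⟶ P, f ≫ h = g

/-- Take the cone Z of a left approximation f : Y → Q. A map Z → P[i] with i > 0 vanishes on Q, so
it comes from Y[1] → P[i], that is, from Y → P[i-1]. This factors through f: by the approximation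
property if i = 1, and because it is zero if i > 1. As δ ≫ f[1] = 0, the map is zero. -/
theorem exists_approximation_triangle {𝒬 : ObjectProperty D} [𝒬.IsTriangulatedClosed₃] {P Y : D}
    (hP : VanishesAbove P P) (happ : HasLeftApproximations 𝒬 P) (hY : 𝒬 Y)
    (hYP : VanishesAbove Y P) :
    ∃ (Q Z : D) (f : Y ⟶ Q) (g : Q ⟶ Z) (δ : Z ⟶ Y⟦(1 : ℤ)⟧), IsSummandOfCopies P Q ∧ 𝒬 Z ∧
      VanishesAbove Z P ∧ Triangle.mk f g δ ∈ distTriang D := by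
  obtain ⟨Q, hQ, hQP, f, hf⟩ := happ Y hY
  obtain ⟨Z, hZ, g, δ, hT⟩ := 𝒬.distinguished_cocone_triangle f hY hQ
  refine ⟨Q, Z, f, g, δ, hQP, hZ, fun i hi a => ?_, hT⟩
  obtain ⟨b, rfl⟩ : ∃ b : Y⟦(1 : ℤ)⟧ ⟶ P⟦i⟧, a = δ ≫ b := Triangle.yoneda_exact₃ _ hT a (hQP.eq_zero_of_source (hP i hi) _)
  obtain ⟨c, hc⟩ := (shiftFunctor D (1 : ℤ)).map_surjective
    (b ≫ (shiftFunctorAdd' D (i - 1) 1 i (by lia)).hom.app P)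
  obtain ⟨h, rfl⟩ : ∃ h : Q ⟶ P⟦i - 1⟧, f ≫ h = c := by
    obtain hi | hi := (show 0 ≤ i - 1 by lia).eq_or_lt
    · obtain ⟨h, hh⟩ := hf (c ≫ (shiftFunctorZero' D (i - 1) hi.symm).hom.app P)
      refine ⟨h ≫ (shiftFunctorZero' D (i - 1) hi.symm).inv.app P, ?_⟩
      rw [← Category.assoc, hh, Category.assoc, Iso.hom_inv_id_app, Category.comp_id]
    · exact ⟨0, by rw [hYP _ hi c, comp_zero]⟩
  have hδ : δ ≫ f⟦(1 : ℤ)⟧' = 0 := comp_distTriang_mor_zero₃₁ _ hT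
  rw [← cancel_mono ((shiftFunctorAdd' D (i - 1) 1 i (by lia)).hom.app P), Category.assoc]
  rw [← hc, Functor.map_comp, ← Category.assoc, hδ, zero_comp, zero_comp]

/-- By the approximation triangle L → Q → Z → L[1], g extends to Q as soon as Z → L[1] → N[1] is
zero. More generally, every composite Y → L[i] → N[i] vanishes for i > 0. For i ≥ m the first map is
zero. Otherwise the case i + 1 for the cone of Y → Q extends the composite to Q, and there are no
nonzero maps Q → N[i]. N need not satisfy 𝒬, so it can be a module of infinite projective dimension.
-/
theorem exists_factorization_of_vanishesAbove {𝒬 : ObjectProperty D} [𝒬.IsTriangulatedClosed₃]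
    {P L N : D} (hP : VanishesAbove P P) (happ : HasLeftApproximations 𝒬 P) (hL : 𝒬 L)
    (hLP : VanishesAbove L P) (hev : eventuallyVanishing 𝒬 P L) (hN : VanishesAbove P N)
    (g : L ⟶ N) : ∃ (Q : D) (f : L ⟶ Q) (h : Q ⟶ N), IsSummandOfCopies P Q ∧ f ≫ h = g := by
  obtain ⟨m, hm⟩ := hev
  -- `k` measures how far i is below the bound m; Y stays quantified since it changes from step to
  -- step.
  have H (k : ℕ) : ∀ i : ℤ, 0 < i → m ≤ i + k → ∀ Y, 𝒬 Y → VanishesAbove Y P →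
      ∀ h : Y ⟶ L⟦i⟧, h ≫ g⟦i⟧' = 0 := by
    induction k with
    | zero => exact fun i _ hi Y hY hYP h => by rw [hm Y hY hYP i (by lia) h, zero_comp]
    | succ k ih =>
      intro i hi hik Y hY hYP h
      obtain ⟨Q, Z, f, p, δ, hQP, hZ, hZP, hT⟩ := exists_approximation_triangle hP happ hY hYP
      obtain ⟨q, hq⟩ := exists_comp_eq_of_shift hT (h ≫ g⟦i⟧') (by
        have := ih (i + 1) (by lia) (by lia) Z hZ hZP
          (δ ≫ h⟦(1 : ℤ)⟧' ≫ (shiftFunctorAdd D i 1).inv.app L)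
        rw [← cancel_mono ((shiftFunctorAdd D i 1).inv.app N), zero_comp, Functor.map_comp, ← this]
        simp only [Category.assoc]
        congr 2
        exact (shiftFunctorAdd D i 1).inv.naturality g)
      rw [← hq, hQP.eq_zero_of_source (hN i hi) q, comp_zero]
  obtain ⟨Q, Z, f, p, δ, hQP, hZ, hZP, hT⟩ := exists_approximation_triangle hP happ hL hLP
  obtain ⟨q, hq⟩ := exists_comp_eq_of_shift hT g
    (H (m.toNat) 1 (by lia) (by lia) Z hZ hZP δ)
  exact ⟨Q, f, q, hQP, hq⟩

end Triangulated

/-! ### Approximations and vanishing bounds in K^b(proj Λ) -/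

section Homotopy

open CochainComplex.HomComplex

variable {R Λ : Type u} [CommRing R] [Ring Λ] [Algebra R Λ]

open scoped ModuleCat.Algebra in
theorem finite_hom_of_boundedProj [IsArtinAlgebra R Λ] {K L : CochainComplex (ModuleCat.{u} Λ) ℤ}
    (hK : boundedProj Λ K) (hL : boundedProj Λ L) : Module.Finite R (K ⟶ L) := by
  have := IsArtinAlgebra.isArtinianRing_base (R := R) (Λ := Λ)
  obtain ⟨⟨a, ha⟩, ⟨b, hb⟩, hK⟩ := hK
  have h (i : Finset.Icc a b) : Module.Finite R (K.X i ⟶ L.X i) := by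
    have := (hK i).1
    have := (hL.2.2 i).1
    exact finite_hom _ _
  let f : (K ⟶ L) →ₗ[R] ∀ i : Finset.Icc a b, (K.X i ⟶ L.X i) :=
    { toFun := fun g i => g.f i
      map_add' := fun _ _ => rfl
      map_smul' := fun _ _ => rfl }
  refine Module.Finite.of_injective f fun g g' hg => HomologicalComplex.hom_ext _ _ fun i => ?_
  by_cases hi : i ∈ Finset.Icc a b
  · exact congrFun hg ⟨i, hi⟩
  · refine IsZero.eq_of_src ?_ _ _
    rw [Finset.mem_Icc, not_and_or, not_le, not_le] at hi
    obtain hi | hi := hi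
    · exact K.isZero_of_isStrictlyGE a i hi
    · exact K.isZero_of_isStrictlyLE b i hi

/-- Chain maps between bounded complexes form a finitely generated R-module, and every morphism of
K^b(proj Λ) is represented by one. The coefficients are recorded as endomorphisms of P, so no
R-linear structure on the homotopy category is needed. -/
theorem exists_generators_Kb (R : Type u) {Λ : Type u} [CommRing R] [Ring Λ] [Algebra R Λ]
    [IsArtinAlgebra R Λ] (Y P : Kb Λ) :
    ∃ (k : ℕ) (g : Fin k → (Y ⟶ P)), ∀ f : Y ⟶ P, ∃ e : Fin k → (P ⟶ P),
      ∑ j, g j ≫ e j = f := by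
  let _ : Linear R (ModuleCat.{u} Λ) := ModuleCat.Algebra.instLinear
  obtain ⟨Y, hY⟩ := Y
  obtain ⟨P, hP⟩ := P
  obtain ⟨Y : CochainComplex _ _, rfl⟩ := Y.quotient_obj_surjective
  obtain ⟨P : CochainComplex _ _, rfl⟩ := P.quotient_obj_surjective
  have : Module.Finite R (Y ⟶ P) := finite_hom_of_boundedProj
    ((homotopyBoundedProj_quotient_obj_iff _).1 hY) ((homotopyBoundedProj_quotient_obj_iff _).1 hP)
  obtain ⟨k, g, hg⟩ := exists_generators (R := R) Y P
  refine ⟨k, fun j => (homotopyBoundedProj Λ).homMk ((HomotopyCategory.quotient _ _).map (g j)),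
    fun f => ?_⟩
  obtain ⟨f', hf'⟩ := (HomotopyCategory.quotient _ _).map_surjective f.hom
  obtain ⟨r, rfl⟩ := hg f'
  refine ⟨fun j => (homotopyBoundedProj Λ).homMk
    ((HomotopyCategory.quotient _ _).map (r j • 𝟙 P)), ?_⟩
  apply (homotopyBoundedProj Λ).ι.map_injective
  rw [Functor.map_sum]
  refine Eq.trans ?_ hf'
  rw [Functor.map_sum]
  refine Finset.sum_congr rfl fun j _ => ?_
  have : r j • g j = g j ≫ (r j • 𝟙 P) := by simp
  rw [this, Functor.map_comp]
  rfl

theorem hasLeftApproximations (R : Type u) {Λ : Type u} [CommRing R] [Ring Λ] [Algebra R Λ]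
    [IsArtinAlgebra R Λ] (P : Kb Λ) :
    HasLeftApproximations (homotopyBoundedProj Λ) P.obj := by
  intro Y hY
  obtain ⟨k, g, hg⟩ := exists_generators_Kb R ⟨Y, hY⟩ P
  have hQ : IsSummandOfCopies P (⨁ fun _ : Fin k => P) :=
    ⟨k, biproduct.π _, biproduct.ι _, biproduct.total⟩
  refine ⟨(⨁ fun _ : Fin k => P).obj, (⨁ fun _ : Fin k => P).property,
    hQ.map (homotopyBoundedProj Λ).ι, (biproduct.lift g).hom, fun f => ?_⟩
  obtain ⟨e, he⟩ := hg ((homotopyBoundedProj Λ).homMk f)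
  refine ⟨(biproduct.desc e).hom, ?_⟩
  have : biproduct.lift g ≫ biproduct.desc e = (homotopyBoundedProj Λ).homMk f := by
    rw [biproduct.lift_desc, he]
  exact congrArg InducedCategory.Hom.hom this

theorem IsPresilting.vanishesAbove {P : Kb Λ} (h : IsPresilting P) :
    VanishesAbove P.obj P.obj := by
  intro i hi f
  let e : P.obj⟦i⟧ ≅ (P⟦i⟧).obj := ((homotopyBoundedProj Λ).ι.commShiftIso i).symm.app P
  rw [← cancel_mono e.hom, zero_comp]
  exact congrArg InducedCategory.Hom.hom (h i hi ((homotopyBoundedProj Λ).homMk (f ≫ e.hom)))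

/-- The objects with a uniform vanishing bound form a triangulated subcategory containing add(P),
hence all of K^b(proj Λ). This is the only use of the generation half of silting. -/
theorem IsSilting.prop_eventuallyVanishing {P : Kb Λ} (h : IsSilting P) (L : Kb Λ) :
    eventuallyVanishing (homotopyBoundedProj Λ) P.obj L.obj := by
  have := h.2 ((eventuallyVanishing (homotopyBoundedProj Λ) P.obj).inverseImage
    (homotopyBoundedProj Λ).ι) inferInstance inferInstance fun E hE =>
      (hE.isSummandOfCopies.map (homotopyBoundedProj Λ).ι).prop_eventuallyVanishing _
  exact (this ▸ trivial : ((eventuallyVanishing (homotopyBoundedProj Λ) P.obj).inverseImage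
    (homotopyBoundedProj Λ).ι) L)

end Homotopy

/-! ### Maps to and from the truncated resolution -/

section Truncation

open CochainComplex.HomComplex

variable {R Λ : Type u} [CommRing R] [Ring Λ] [Algebra R Λ]

theorem forall_eq_zero_iff_mem_coboundaries (K L : CochainComplex (ModuleCat.{u} Λ) ℤ) (i : ℤ) :
    (∀ f : (HomotopyCategory.quotient _ _).obj K ⟶ ((HomotopyCategory.quotient _ _).obj L)⟦i⟧,
      f = 0) ↔ ∀ z : Cocycle K L i, z ∈ coboundaries K L i := by
  rw [HomotopyCategory.shift_quotient_obj]
  refine ⟨fun h z => (CohomologyClass.toHom_mk_eq_zero_iff z).1 (h _), fun h f => ?_⟩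
  obtain ⟨z, rfl⟩ := (CohomologyClass.toHom_bijective K L i).2 f
  obtain ⟨z, rfl⟩ := z.mk_surjective
  exact (CohomologyClass.toHom_mk_eq_zero_iff z).2 (h z)

/-- The comparison theorem in shifted form: a cocycle in degree c lifts to maps P_{c+j} → P_j
commuting with d up to the sign `s`, as long as the truncation at n is not exceeded. -/
theorem exists_lift_sequence {M : ModuleCat.{u} Λ} (P : ProjectiveResolution M) (n c : ℕ)
    (s : ℤˣ)
    (φ : P.complex.X c ⟶ M) (hφ : c < n → P.complex.d (c + 1) c ≫ φ = 0) :
    ∃ g : ∀ j, P.complex.X (c + j) ⟶ P.complex.X j, g 0 ≫ augmentation P = φ ∧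
      ∀ j, c + j + 1 ≤ n →
        g (j + 1) ≫ P.complex.d (j + 1) j = s • (P.complex.d (c + j + 1) (c + j) ≫ g j) := by
  obtain ⟨g₀, hg₀⟩ := exists_lift_of_surjective (augmentation_surjective P) φ
  -- The next lift is chosen if there is one, and 0 otherwise; the induction below shows that it
  -- exists whenever c + j + 1 ≤ n.
  let g : ∀ j, P.complex.X (c + j) ⟶ P.complex.X j := fun j =>
    Nat.rec (motive := fun j => P.complex.X (c + j) ⟶ P.complex.X j) g₀
      (fun j f => open Classical in
        if h : ∃ f' : P.complex.X (c + j + 1) ⟶ P.complex.X (j + 1),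
          f' ≫ P.complex.d (j + 1) j = s • (P.complex.d (c + j + 1) (c + j) ≫ f)
        then h.choose else 0) j
  have hg (j : ℕ) (h : ∃ f' : P.complex.X (c + j + 1) ⟶ P.complex.X (j + 1),
      f' ≫ P.complex.d (j + 1) j = s • (P.complex.d (c + j + 1) (c + j) ≫ g j)) :
      g (j + 1) ≫ P.complex.d (j + 1) j = s • (P.complex.d (c + j + 1) (c + j) ≫ g j) := by
    have : g (j + 1) = h.choose := dif_pos h
    rw [this]
    exact h.choose_spec
  refine ⟨g, hg₀, fun j => ?_⟩
  induction j with
  | zero =>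
    intro hj
    refine hg 0 ⟨P.exact₀.liftFromProjective (s • (P.complex.d (c + 1) c ≫ g₀)) ?_,
      P.exact₀.liftFromProjective_comp _ _⟩
    change (s • (P.complex.d (c + 1) c ≫ g₀)) ≫ augmentation P = 0
    rw [Linear.units_smul_comp, Category.assoc, hg₀, hφ (by lia), smul_zero]
  | succ j ih =>
    intro hj
    refine hg (j + 1) ⟨(P.exact_succ j).liftFromProjective
      (s • (P.complex.d (c + j + 2) (c + j + 1) ≫ g (j + 1))) ?_,
      (P.exact_succ j).liftFromProjective_comp _ _⟩
    change (s • (P.complex.d (c + j + 2) (c + j + 1) ≫ g (j + 1))) ≫ P.complex.d (j + 1) j = 0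
    rw [Linear.units_smul_comp, Category.assoc, ih (by lia), Linear.comp_units_smul,
      ← Category.assoc, HomologicalComplex.d_comp_d, zero_comp, smul_zero, smul_zero]

/-- Lift φ to a cocycle z of degree i + 1 on T and write z = δ y. In the component from degree
-(i+1) to 0, followed by the augmentation, the term of δ y ending in the differential T^{-1} → T^0
dies. What remains expresses φ as d followed by a map, up to sign. -/
theorem homExact_of_cocycles_mem_coboundaries {M : ModuleCat.{u} Λ} (P : ProjectiveResolution M)
    (n : ℕ)
    (T : CochainComplex (ModuleCat.{u} Λ) ℤ) (hT₀ : ∀ p, 0 < p → IsZero (T.X p))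
    (hTn : ∀ p < -(n : ℤ), IsZero (T.X p))
    (e : ∀ (p : ℤ) (k : ℕ), k ≤ n → -(k : ℤ) = p → (T.X p ≅ P.complex.X k))
    (he : ∀ (p q : ℤ) (k : ℕ) (hp : -((k + 1 : ℕ) : ℤ) = p) (hq : -(k : ℤ) = q) (hk : k + 1 ≤ n),
      T.d p q = (e p (k + 1) hk hp).hom ≫ P.complex.d (k + 1) k ≫
        (e q k (Nat.le_of_succ_le hk) hq).inv)
    (h : ∀ i, 0 < i → ∀ z : Cocycle T T i, z ∈ coboundaries T T i) :
    HomExact P.complex n M 0 := by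
  intro i _ hi φ hφ
  obtain ⟨s, hs⟩ : ∃ s : ℤˣ, s = ((i + 1 : ℕ) + 1 : ℤ).negOnePow := ⟨_, rfl⟩
  -- In δ z, for z of degree i + 1, the term d ≫ z carries the sign s; lifting with -s makes the two
  -- terms cancel.
  obtain ⟨g, hg₀, hg⟩ := exists_lift_sequence P n (i + 1) (-s) φ hφ
  -- `α` and `β` are the identifications `e` and their inverses, extended by 0 to k > n so that they
  -- need no proof of k ≤ n.
  obtain ⟨α, hα'⟩ : ∃ α : ∀ (p : ℤ) (k : ℕ), -(k : ℤ) = p → (T.X p ⟶ P.complex.X k),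
      ∀ p k hp hk, α p k hp = (e p k hk hp).hom :=
    ⟨fun p k hp => if hk : k ≤ n then (e p k hk hp).hom else 0, fun _ _ _ hk => dif_pos hk⟩
  obtain ⟨β, hβ'⟩ : ∃ β : ∀ (p : ℤ) (k : ℕ), -(k : ℤ) = p → (P.complex.X k ⟶ T.X p),
      ∀ p k hp hk, β p k hp = (e p k hk hp).inv :=
    ⟨fun p k hp => if hk : k ≤ n then (e p k hk hp).inv else 0, fun _ _ _ hk => dif_pos hk⟩
  have hβα (p : ℤ) (k : ℕ) (hp : -(k : ℤ) = p) (hk : k ≤ n) : β p k hp ≫ α p k hp = 𝟙 _ := by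
    simp [hα' p k hp hk, hβ' p k hp hk]
  have hα (p q : ℤ) (k : ℕ) (hp : -((k + 1 : ℕ) : ℤ) = p) (hq : -(k : ℤ) = q) (hk : k + 1 ≤ n) :
      T.d p q ≫ α q k hq = α p (k + 1) hp ≫ P.complex.d (k + 1) k := by
    simp [hα' q k hq (by omega), hα' p (k + 1) hp hk, he p q k hp hq hk]
  have hβ (p q : ℤ) (k : ℕ) (hp : -((k + 1 : ℕ) : ℤ) = p) (hq : -(k : ℤ) = q) (hk : k + 1 ≤ n) :
      β p (k + 1) hp ≫ T.d p q = P.complex.d (k + 1) k ≫ β q k hq := by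
    simp [hβ' q k hq (by omega), hβ' p (k + 1) hp hk, he p q k hp hq hk]
  obtain ⟨z, hz⟩ : ∃ z : Cochain T T (i + 1 : ℕ), ∀ (p q : ℤ) (hpq : p + (i + 1 : ℕ) = q) (j : ℕ)
      (hj : -(j : ℤ) = q), z.v p q hpq = α p (i + 1 + j) (by omega) ≫ g j ≫ β q j hj := by
    refine ⟨Cochain.mk fun p q hpq =>
      if hq : q ≤ 0 then α p (i + 1 + (-q).toNat) (by omega) ≫ g (-q).toNat ≫
        β q (-q).toNat (by omega) else 0, fun p q hpq j hj => ?_⟩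
    obtain rfl : j = (-q).toNat := by omega
    exact dif_pos (by omega)
  have hδ : δ ((i + 1 : ℕ) : ℤ) ((i + 1 : ℕ) + 1) z = 0 := by
    refine Cochain.ext _ _ fun p q hpq => ?_
    by_cases hq : 0 < q
    · exact (hT₀ q hq).eq_of_tgt _ _
    by_cases hp : p < -n
    · exact (hTn p hp).eq_of_src _ _
    obtain ⟨j, hj⟩ : ∃ j : ℕ, -(j : ℤ) = q := ⟨(-q).toNat, by omega⟩
    rw [δ_v _ _ rfl z p q hpq (q - 1) (p + 1) rfl rfl, hz p (q - 1) (by omega) (j + 1) (by omega),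
      hz (p + 1) q (by omega) j hj, Category.assoc, Category.assoc,
      hβ (q - 1) q j (by omega) hj (by omega), ← Category.assoc (T.d p (p + 1)),
      hα p (p + 1) (i + 1 + j) (by omega) (by omega) (by omega), ← Category.assoc (g (j + 1)),
      hg j (by omega), ← hs]
    simp only [Linear.units_smul_comp, Linear.comp_units_smul, Category.assoc, Units.neg_smul,
      Preadditive.comp_neg, Preadditive.neg_comp]
    exact neg_add_cancel _
  obtain ⟨y, hy⟩ := (mem_coboundaries_iff _ (i : ℤ) (by simp)).1
    (h (i + 1 : ℕ) (by omega) (Cocycle.mk z _ rfl hδ))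
  have hv := Cochain.congr_v hy (-(i + 1 : ℕ)) 0 (by omega)
  rw [δ_v _ _ (by simp) y _ 0 _ (-1) (-i) (by omega) (by omega)] at hv
  change _ = z.v _ _ _ at hv
  rw [hz _ 0 _ 0 rfl] at hv
  have h1 : T.d (-1) 0 ≫ α 0 0 rfl ≫ augmentation P = 0 := by
    rw [← Category.assoc, hα (-1) 0 0 rfl rfl (by omega), Category.assoc, d_comp_augmentation,
      comp_zero]
  have h2 : β _ (i + 1) rfl ≫ T.d (-(i + 1 : ℕ)) (-i) = P.complex.d (i + 1) i ≫ β (-i) i rfl :=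
    hβ _ _ i rfl rfl hi
  have h3 : β 0 0 rfl ≫ α 0 0 rfl = 𝟙 _ := hβα 0 0 rfl (by omega)
  have h4 : β _ (i + 1) rfl ≫ α _ (i + 1) rfl = 𝟙 _ := hβα _ (i + 1) rfl hi
  refine ⟨((i + 1 : ℕ) : ℤ).negOnePow • (β (-i) i rfl ≫ y.v (-i) 0 (by omega) ≫ α 0 0 rfl ≫
    augmentation P), ?_⟩
  have hv' := congrArg (fun f => β _ (i + 1) rfl ≫ f ≫ α 0 0 rfl ≫ augmentation P) hv
  rw [Preadditive.add_comp, Category.assoc, h1, comp_zero, zero_add, Linear.units_smul_comp,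
    Linear.comp_units_smul, Category.assoc, ← Category.assoc (β _ _ _), h2] at hv'
  rw [Linear.comp_units_smul, ← Category.assoc]
  refine hv'.trans ?_
  have : β _ (i + 1) rfl ≫ (α _ (i + 1) rfl ≫ g 0 ≫ β 0 0 rfl) ≫ α 0 0 rfl ≫ augmentation P =
      (β _ (i + 1) rfl ≫ α _ (i + 1) rfl) ≫ g 0 ≫ (β 0 0 rfl ≫ α 0 0 rfl) ≫ augmentation P := by
    simp only [Category.assoc]
  refine this.trans ?_
  rw [h3, h4, Category.id_comp, Category.id_comp]
  exact hg₀

/-- The module `N` as a complex in degree `0`. -/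
noncomputable abbrev stalkComplex (N : ModuleCat.{u} Λ) : CochainComplex (ModuleCat.{u} Λ) ℤ :=
  (CochainComplex.singleFunctor _ 0).obj N

/-- The module `N` as a complex in degree `0`, up to homotopy. -/
noncomputable abbrev stalk (N : ModuleCat.{u} Λ) : HomotopyCategory (ModuleCat.{u} Λ) (.up ℤ) :=
  (HomotopyCategory.quotient _ _).obj (stalkComplex N)

/-- The term in degree `0` of the complex given by `N`. -/
noncomputable def stalkXIso (N : ModuleCat.{u} Λ) : (stalkComplex N).X 0 ≅ N :=
  HomologicalComplex.singleObjXSelf (.up ℤ) 0 N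

theorem isZero_stalkComplex_X (N : ModuleCat.{u} Λ) (i : ℤ) (hi : i ≠ 0) :
    IsZero ((stalkComplex N).X i) :=
  HomologicalComplex.isZero_single_obj_X (.up ℤ) 0 N i hi

/-- Both homotopy terms in degree 0 pass through zero objects, so homotopic maps of stalk complexes
agree in degree 0. -/
theorem eq_of_quotient_map_singleFunctor_eq {X Y : ModuleCat.{u} Λ} {f : X ⟶ Y}
    {g : stalkComplex X ⟶ stalkComplex Y}
    (h : (HomotopyCategory.quotient _ _).map g =
      (HomotopyCategory.quotient _ _).map ((CochainComplex.singleFunctor _ 0).map f)) :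
    (stalkXIso X).inv ≫ g.f 0 ≫ (stalkXIso Y).hom = f := by
  have H := (HomotopyCategory.homotopyOfEq _ _ h).comm 0
  have h1 : ((CochainComplex.singleFunctor _ 0).map f).f 0 =
      (stalkXIso X).hom ≫ f ≫ (stalkXIso Y).inv :=
    HomologicalComplex.single_map_f_self _ _ _
  rw [dNext_eq _ (show (ComplexShape.up ℤ).Rel 0 1 by simp),
    prevD_eq _ (show (ComplexShape.up ℤ).Rel (-1) 0 by simp),
    (isZero_stalkComplex_X X 1 (by simp)).eq_of_src
      ((HomotopyCategory.homotopyOfEq _ _ h).hom 1 0) 0,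
    (isZero_stalkComplex_X Y (-1) (by simp)).eq_of_tgt
      ((HomotopyCategory.homotopyOfEq _ _ h).hom 0 (-1)) 0, comp_zero, zero_comp, zero_add,
    zero_add, h1] at H
  rw [H]
  simp

variable [IsArtinAlgebra R Λ] (M : ModuleCat.{u} Λ) [Module.Finite Λ M] (n : ℕ)

variable (R) in
/-- The term of `P^•_{≥ -n}(M)` in a degree `p = -k ≥ -n` is `P^{-k}(M)`. -/
noncomputable def truncResXIso (p : ℤ) (k : ℕ) (hk : k ≤ n) (hp : -(k : ℤ) = p) :
    (truncRes R Λ M n).X p ≅ (minRes R Λ M).complex.X k :=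
  HomologicalComplex.stupidTruncXIso _ _ (i := n - k) (by
      simp only [ComplexShape.embeddingUpIntGE_f]; lia) ≪≫
    (minRes R Λ M).cochainComplexXIso p k hp

theorem truncRes_d (p q : ℤ) (k : ℕ) (hk : k + 1 ≤ n) (hp : -((k + 1 : ℕ) : ℤ) = p)
    (hq : -(k : ℤ) = q) :
    (truncRes R Λ M n).d p q = (truncResXIso R M n p (k + 1) hk hp).hom ≫
      (minRes R Λ M).complex.d (k + 1) k ≫ (truncResXIso R M n q k (by lia) hq).inv := by
  have hp' : (ComplexShape.embeddingUpIntGE (-n)).f (n - (k + 1)) = p := by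
    simp only [ComplexShape.embeddingUpIntGE_f]; lia
  have hq' : (ComplexShape.embeddingUpIntGE (-n)).f (n - k) = q := by
    simp only [ComplexShape.embeddingUpIntGE_f]; lia
  have h : (truncRes R Λ M n).d p q =
      (HomologicalComplex.stupidTruncXIso (minRes R Λ M).cochainComplex _ hp').hom ≫
        (minRes R Λ M).cochainComplex.d p q ≫
        (HomologicalComplex.stupidTruncXIso (minRes R Λ M).cochainComplex _ hq').inv := by
    have h0 := HomologicalComplex.extend_d_eq ((minRes R Λ M).cochainComplex.restriction
      (ComplexShape.embeddingUpIntGE (-n))) (ComplexShape.embeddingUpIntGE (-n)) hp' hq'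
    refine h0.trans ?_
    subst hp' hq'
    exact congrArg₂ (fun a b => a ≫ (minRes R Λ M).cochainComplex.d _ _ ≫ b)
      (Category.comp_id _).symm (Category.id_comp _).symm
  rw [h, (minRes R Λ M).cochainComplex_d p q (k + 1) k hp hq]
  change _ = (_ ≫ _) ≫ _ ≫ (_ ≫ _)
  simp only [Category.assoc]

variable (R) in
theorem isZero_truncRes_of_lt (p : ℤ) (hp : p < -n) : IsZero ((truncRes R Λ M n).X p) :=
  HomologicalComplex.isZero_stupidTrunc_X _ _ p
    (fun j => by simp only [ComplexShape.embeddingUpIntGE_f]; lia)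

variable (R) in
theorem isZero_truncRes_of_pos (p : ℤ) (hp : 0 < p) : IsZero ((truncRes R Λ M n).X p) := by
  have : (truncRes R Λ M n).IsStrictlyLE 0 := by dsimp only [truncRes]; infer_instance
  exact (truncRes R Λ M n).isZero_of_isStrictlyLE 0 p

variable {M n}

/-- Maps from the truncation to N[i] are the i-th cohomology of its Hom complex into N. For i = n
every map P^{-n} → N is a cocycle since the truncation is zero in degree -n - 1, and for i > n there
is nothing to show. -/
theorem vanishesAbove_stalk {N : ModuleCat.{u} Λ} (hN : HomExact (minRes R Λ M).complex n N 0) :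
    VanishesAbove (truncKb R Λ M n).obj (stalk N) := by
  intro i hi
  refine (forall_eq_zero_iff_mem_coboundaries _ _ i).2 fun z => ?_
  obtain ⟨f, hf, rfl⟩ := Cocycle.toSingleMk_surjective z (-i) (by lia) (-i - 1) (by lia)
  refine (Cocycle.toSingleMk_mem_coboundaries_iff f _ _ _ hf (-i + 1) rfl).2 ?_
  by_cases hin : -i < -n
  · exact ⟨0, (isZero_truncRes_of_lt R M n _ hin).eq_of_src _ _⟩
  obtain ⟨k, rfl⟩ : ∃ k : ℕ, i = k + 1 := ⟨(i - 1).toNat, by lia⟩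
  have hkn : k + 1 ≤ n := by lia
  have hk1 : -((k + 1 : ℕ) : ℤ) = -((k : ℤ) + 1) := by lia
  obtain ⟨ψ, hψ⟩ := hN k (by lia) (by lia) ((truncResXIso R M n _ (k + 1) hkn hk1).inv ≫ f)
    fun h => by
      rw [truncRes_d M n _ _ (k + 1) (by lia) (by lia) hk1, Category.assoc, Category.assoc] at hf
      rw [← cancel_epi (truncResXIso R M n (-(↑k + 1) - 1) (k + 1 + 1) (by lia) (by lia)).hom, hf,
        comp_zero]
  refine ⟨(truncResXIso R M n _ k (by lia) (by lia)).hom ≫ ψ, ?_⟩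
  rw [truncRes_d M n _ _ k hkn hk1 (by lia)]
  simp [hψ]

theorem vanishesAbove_of_stalk (N : ModuleCat.{u} Λ) :
    VanishesAbove (stalk N) (truncKb R Λ M n).obj := by
  intro i hi
  refine (forall_eq_zero_iff_mem_coboundaries _ _ i).2 fun z => ?_
  obtain ⟨f, hf, rfl⟩ := Cocycle.fromSingleMk_surjective z i (by lia) (i + 1) rfl
  refine (Cocycle.fromSingleMk_mem_coboundaries_iff f _ _ _ hf (i - 1) (by lia)).2 ?_
  exact ⟨0, (isZero_truncRes_of_pos R M n i hi).eq_of_tgt _ _⟩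

theorem homExact_of_vanishesAbove
    (h : VanishesAbove (truncKb R Λ M n).obj (truncKb R Λ M n).obj) :
    HomExact (minRes R Λ M).complex n M 0 :=
  homExact_of_cocycles_mem_coboundaries (minRes R Λ M) n (truncRes R Λ M n)
    (isZero_truncRes_of_pos R M n) (isZero_truncRes_of_lt R M n) (truncResXIso R M n)
    (fun p q k hp hq hk => truncRes_d M n p q k hk hp hq)
    fun i hi => (forall_eq_zero_iff_mem_coboundaries _ _ i).1 (h i hi)

variable (R) in
-- The element x is a map from the stalk Λ to the stalk N, and it factors through a sum of copies of
-- the truncation. The legs to N descend to maps `g j` out of M, and the legs from Λ give elements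
-- of M as images of 1.
theorem exists_sum_eq_of_isSilting (hn : 1 ≤ n) (h : IsTauTilting R Λ M n)
    {N : ModuleCat.{u} Λ}
    (hN : HomExact (minRes R Λ M).complex n N 0) (x : N) :
    ∃ (k : ℕ) (g : Fin k → (M ⟶ N)) (m : Fin k → M), ∑ j, (g j).hom (m j) = x := by
  let Λ₀ := ModuleCat.of Λ Λ
  have hΛ : homotopyBoundedProj Λ (stalk Λ₀) := by
    refine (homotopyBoundedProj_quotient_obj_iff _).2 ⟨⟨0, inferInstance⟩, ⟨0, inferInstance⟩,
      fun i => ?_⟩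
    by_cases hi : i = 0
    · subst hi
      exact ⟨inferInstanceAs (Module.Finite Λ Λ), inferInstanceAs (Module.Projective Λ Λ)⟩
    · have : Subsingleton ((stalkComplex Λ₀).X i) :=
        ModuleCat.subsingleton_of_isZero
          (isZero_stalkComplex_X Λ₀ i hi)
      exact ⟨inferInstance, Module.Projective.of_free⟩
  let x' : Λ₀ ⟶ N := ModuleCat.ofHom (LinearMap.toSpanSingleton Λ N x)
  obtain ⟨Q, f, q, ⟨k, a, b, hab⟩, hfq⟩ := exists_factorization_of_vanishesAbove
    h.1.vanishesAbove (hasLeftApproximations R _) hΛ (vanishesAbove_of_stalk Λ₀)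
    (h.prop_eventuallyVanishing ⟨_, hΛ⟩) (vanishesAbove_stalk hN)
    ((HomotopyCategory.quotient _ _).map ((CochainComplex.singleFunctor _ 0).map x'))
  obtain ⟨s, hs⟩ : ∃ s : Fin k → (stalkComplex Λ₀ ⟶ truncRes R Λ M n),
      ∀ j, (HomotopyCategory.quotient _ _).map (s j) = f ≫ a j :=
    ⟨fun j => ((HomotopyCategory.quotient _ _).map_surjective (f ≫ a j)).choose,
      fun j => ((HomotopyCategory.quotient _ _).map_surjective (f ≫ a j)).choose_spec⟩
  obtain ⟨t, ht⟩ : ∃ t : Fin k → (truncRes R Λ M n ⟶ stalkComplex N),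
      ∀ j, (HomotopyCategory.quotient _ _).map (t j) = b j ≫ q :=
    ⟨fun j => ((HomotopyCategory.quotient _ _).map_surjective (b j ≫ q)).choose,
      fun j => ((HomotopyCategory.quotient _ _).map_surjective (b j ≫ q)).choose_spec⟩
  have hst : (HomotopyCategory.quotient _ _).map (∑ j, s j ≫ t j) =
      (HomotopyCategory.quotient _ _).map ((CochainComplex.singleFunctor _ 0).map x') := by
    rw [Functor.map_sum, ← hfq, ← Category.id_comp q, ← hab, Preadditive.sum_comp,
      Preadditive.comp_sum]
    refine Finset.sum_congr rfl fun j _ => ?_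
    rw [Functor.map_comp, hs, ht]
    exact (Category.assoc _ _ _).trans (congrArg (f ≫ ·) (Category.assoc _ _ _).symm)
  have hx := eq_of_quotient_map_singleFunctor_eq hst
  -- The stalk N is zero in degree -1, so `t j` kills boundaries in degree 0. Since n ≥ 1, the term
  -- P^{-1} survives truncation, and the cokernel in degree 0 is M.
  have ht' (j : Fin k) : (minRes R Λ M).complex.d 1 0 ≫ (truncResXIso R M n 0 0 (by lia) rfl).inv ≫
      (t j).f 0 = 0 := by
    have h1 := (t j).comm (-1) 0
    rw [truncRes_d M n (-1) 0 0 hn rfl rfl] at h1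
    rw [← cancel_epi (truncResXIso R M n (-1) 1 hn rfl).hom, comp_zero]
    simp only [Category.assoc] at h1
    refine h1.symm.trans ?_
    rw [(isZero_stalkComplex_X N (-1) (by simp)).eq_of_tgt
      ((t j).f (-1)) 0]
    exact zero_comp
  have hg (j : Fin k) : ∃ g : M ⟶ N, augmentation (minRes R Λ M) ≫ g =
      (truncResXIso R M n 0 0 (by lia) rfl).inv ≫ (t j).f 0 ≫
        (stalkXIso N).hom :=
    exists_augmentation_comp _ _ (by
      have := congrArg (· ≫ (stalkXIso N).hom) (ht' j)
      simp only [Category.assoc, zero_comp] at this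
      exact this)
  choose g hg using hg
  let u (j : Fin k) : Λ₀ ⟶ M := (stalkXIso Λ₀).inv ≫ (s j).f 0 ≫
    (truncResXIso R M n 0 0 (by lia) rfl).hom ≫ augmentation (minRes R Λ M)
  have hu : ∑ j, u j ≫ g j = x' := by
    have hsum : (∑ j, s j ≫ t j).f 0 = ∑ j, (s j ≫ t j).f 0 :=
      (HomologicalComplex.eval _ _ 0).map_sum _ _
    rw [← hx, hsum, Preadditive.sum_comp, Preadditive.comp_sum]
    refine Finset.sum_congr rfl fun j _ => ?_
    simp only [u, Category.assoc]
    rw [hg, Iso.hom_inv_id_assoc]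
    rfl
  refine ⟨k, g, fun j => (u j).hom 1, ?_⟩
  have := congrArg (fun v : Λ₀ ⟶ N => v.hom (1 : Λ)) hu
  simp only [ModuleCat.hom_sum, LinearMap.sum_apply] at this
  exact this.trans (one_smul Λ x)

end Truncation

/-! ### Ext from a projective resolution -/

section ExtComputation

variable {Λ : Type u} [Ring Λ]

theorem subsingleton_ext_iff {M : ModuleCat.{u} Λ} (P : ProjectiveResolution M)
    (N : ModuleCat.{u} Λ) (i : ℕ) :
    Subsingleton (Abelian.Ext.{u} M N (i + 1)) ↔ ∀ φ : P.complex.X (i + 1) ⟶ N,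
      P.complex.d (i + 2) (i + 1) ≫ φ = 0 → ∃ ψ : P.complex.X i ⟶ N,
        P.complex.d (i + 1) i ≫ ψ = φ := by
  refine ⟨fun _ φ hφ => (P.extMk_eq_zero_iff φ (i + 2) rfl hφ i rfl).1 (Subsingleton.elim _ _),
    fun h => subsingleton_of_forall_eq 0 fun α => ?_⟩
  obtain ⟨φ, hφ, rfl⟩ := P.extMk_surjective α (i + 2) rfl
  exact (P.extMk_eq_zero_iff φ (i + 2) rfl hφ i rfl).2 (h φ hφ)

end ExtComputation

/-! ### Duality between Hom(N, ν(P)) and Hom(P, N) -/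

section NakayamaDuality

variable {R Λ : Type u} [CommRing R] [Ring Λ] [Algebra R Λ]

theorem exists_dualBasis (P : Type u) [AddCommGroup P] [Module Λ P] [Module.Finite Λ P]
    [Module.Projective Λ P] :
    ∃ (k : ℕ) (p : Fin k → P) (g : Fin k → (P →ₗ[Λ] Λ)), ∀ x, ∑ a, g a x • p a = x := by
  obtain ⟨k, f, s, -, -, hfs⟩ := Module.Finite.exists_comp_eq_id_of_projective Λ P
  refine ⟨k, fun a => f fun j => if a = j then 1 else 0, fun a => LinearMap.proj a ∘ₗ s, fun x => ?_⟩
  have := LinearMap.congr_fun hfs x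
  rw [LinearMap.comp_apply, LinearMap.id_apply] at this
  conv_rhs => rw [← this, LinearMap.pi_apply_eq_sum_univ f (s x)]
  rfl

/-- The dualizing module is a cogenerator. The cyclic module Rc maps onto some R/m, which embeds in
R/rad(R) because that module is semisimple, and hence in the injective envelope. Injectivity extends
the map from Rc to C. -/
theorem exists_dualizing_ne_zero [IsArtinianRing R] (C : Type u) [AddCommGroup C] [Module R C]
    (c : C) (hc : c ≠ 0) : ∃ β : C →ₗ[R] dualizing R, β c ≠ 0 := by
  let I := Classical.choice (InjectiveEnvelope.nonempty R (R ⧸ Ring.jacobson R))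
  let K : Ideal R := LinearMap.ker (LinearMap.toSpanSingleton R C c)
  have hK : K ≠ ⊤ := fun h => hc (by
    have : (1 : R) ∈ K := h ▸ Submodule.mem_top
    simpa [K] using this)
  obtain ⟨m, hm, hKm⟩ := Ideal.exists_le_maximal K hK
  have hJm : Ring.jacobson R ≤ m := by
    rw [Ring.jacobson_eq_sInf_isMaximal]
    exact sInf_le hm
  obtain ⟨s, hs⟩ : ∃ s : (R ⧸ m) →ₗ[R] (R ⧸ Ring.jacobson R),
      Submodule.factor hJm ∘ₗ s = LinearMap.id :=
    have : IsSemisimpleModule R (R ⧸ Ring.jacobson R) :=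
      (IsArtinian.isSemisimpleModule_iff_jacobson _ _).2 (Module.jacobson_quotient_jacobson R R)
    IsSemisimpleModule.lifting_property (Submodule.factor hJm) (Submodule.factor_surjective hJm)
      LinearMap.id
  let g : LinearMap.range (LinearMap.toSpanSingleton R C c) →ₗ[R] I.E :=
    I.ι ∘ₗ s ∘ₗ Submodule.factor hKm ∘ₗ
      (LinearMap.toSpanSingleton R C c).quotKerEquivRange.symm.toLinearMap
  obtain ⟨β, hβ⟩ := I.injective_E.out
    (LinearMap.range (LinearMap.toSpanSingleton R C c)).subtype Subtype.val_injective g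
  refine ⟨β, fun h => ?_⟩
  have h1 := hβ (LinearMap.rangeRestrict (LinearMap.toSpanSingleton R C c) 1)
  have h2 : β c = 0 := h
  have h3 : g (LinearMap.rangeRestrict (LinearMap.toSpanSingleton R C c) 1) = 0 := by
    rw [← h1]
    simpa using h2
  have h4 : (LinearMap.toSpanSingleton R C c).quotKerEquivRange.symm
      (LinearMap.rangeRestrict (LinearMap.toSpanSingleton R C c) 1) = Submodule.Quotient.mk 1 := by
    rw [LinearEquiv.symm_apply_eq]
    rfl
  have h5 : s (Submodule.Quotient.mk 1) = 0 := I.injective_ι (by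
    rw [map_zero, ← h3]
    simp only [g, LinearMap.comp_apply, LinearEquiv.coe_coe, h4]
    rfl)
  have h6 : (Submodule.Quotient.mk 1 : R ⧸ m) = 0 := by
    have := LinearMap.congr_fun hs (Submodule.Quotient.mk 1)
    rw [LinearMap.comp_apply, h5, map_zero] at this
    exact this.symm
  exact hm.ne_top ((Ideal.eq_top_iff_one m).2 ((Submodule.Quotient.mk_eq_zero m).1 h6))

/-- The value of `φ ∈ ν(P) = Hom_R(P*, k)` at `g ∈ P*`. -/
noncomputable def Nakayama.eval {P : Type u} [AddCommGroup P] [Module Λ P] (g : P →ₗ[Λ] Λ) :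
    Nakayama R Λ P →+ dualizing R where
  toFun φ := (show (P →ₗ[Λ] Λ) →ₗ[R] dualizing R from φ) g
  map_zero' := rfl
  map_add' _ _ := rfl

theorem Nakayama.ext {P : Type u} [AddCommGroup P] [Module Λ P] {φ φ' : Nakayama R Λ P}
    (h : ∀ g, Nakayama.eval g φ = Nakayama.eval g φ') : φ = φ' :=
  LinearMap.ext h

theorem Nakayama.eval_sum {ι : Type*} {P : Type u} [AddCommGroup P] [Module Λ P] (s : Finset ι)
    (g : ι → (P →ₗ[Λ] Λ)) (φ : Nakayama R Λ P) :
    Nakayama.eval (∑ i ∈ s, g i) φ = ∑ i ∈ s, Nakayama.eval (g i) φ :=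
  map_sum (show (P →ₗ[Λ] Λ) →ₗ[R] dualizing R from φ) g s

theorem Nakayama.eval_smul {P : Type u} [AddCommGroup P] [Module Λ P] (g : P →ₗ[Λ] Λ) (a : Λ)
    (φ : Nakayama R Λ P) :
    Nakayama.eval g (a • φ) = Nakayama.eval (MulOpposite.op a • g) φ :=
  rfl

theorem Nakayama.eval_nakayamaMap {P Q : Type u} [AddCommGroup P] [Module Λ P] [AddCommGroup Q]
    [Module Λ Q] (f : P →ₗ[Λ] Q) (g : Q →ₗ[Λ] Λ) (φ : Nakayama R Λ P) :
    Nakayama.eval g (nakayamaMap f φ) = Nakayama.eval (g ∘ₗ f) φ :=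
  rfl

/-- A map `N → ν(P)` is determined by its values on a dual basis of `P`. -/
theorem Nakayama.eval_apply_eq_sum {P N : Type u} [AddCommGroup P] [Module Λ P] [AddCommGroup N]
    [Module Λ N] {k : ℕ} {p : Fin k → P} {b : Fin k → (P →ₗ[Λ] Λ)}
    (hb : ∀ x, ∑ a, b a x • p a = x) (f : N →ₗ[Λ] Nakayama R Λ P) (g : P →ₗ[Λ] Λ) (x : N) :
    Nakayama.eval g (f x) = ∑ a, Nakayama.eval (b a) (f (g (p a) • x)) := by
  have hg : g = ∑ a, MulOpposite.op (g (p a)) • b a := by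
    ext y
    conv_lhs => rw [← hb y]
    simp
  conv_lhs => rw [hg, Nakayama.eval_sum]
  simp_rw [map_smul, Nakayama.eval_smul]

/-- With dual bases, f is a functional on Hom(P, N), and its value on ψ ∘ d is computed from ν(d) ∘
f. If the latter is zero and every φ has the form ψ ∘ d, then f = 0. -/
theorem eq_zero_of_nakayamaMap_comp_eq_zero {P Q N : Type u} [AddCommGroup P] [Module Λ P]
    [AddCommGroup Q] [Module Λ Q] [AddCommGroup N] [Module Λ N] [Module.Finite Λ P]
    [Module.Projective Λ P] [Module.Finite Λ Q] [Module.Projective Λ Q] (d : P →ₗ[Λ] Q)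
    (hd : ∀ φ : P →ₗ[Λ] N, ∃ ψ : Q →ₗ[Λ] N, ψ ∘ₗ d = φ) (f : N →ₗ[Λ] Nakayama R Λ P)
    (hf : ∀ x, nakayamaMap d (f x) = 0) : f = 0 := by
  obtain ⟨k, p, b, hb⟩ := exists_dualBasis (Λ := Λ) P
  obtain ⟨l, q, c, hc⟩ := exists_dualBasis (Λ := Λ) Q
  ext x : 1
  refine Nakayama.ext fun g => ?_
  obtain ⟨ψ, hψ⟩ := hd (LinearMap.toSpanSingleton Λ N x ∘ₗ g)
  have h (a : Fin k) : g (p a) • x = ∑ j, c j (d (p a)) • ψ (q j) := by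
    have := LinearMap.congr_fun hψ (p a)
    rw [LinearMap.comp_apply, ← hc (d (p a)), map_sum] at this
    simpa using this.symm
  rw [Nakayama.eval_apply_eq_sum hb f g x]
  simp_rw [h, map_sum]
  rw [Finset.sum_comm]
  refine Finset.sum_eq_zero fun j _ => ?_
  refine (Nakayama.eval_apply_eq_sum hb f (c j ∘ₗ d) (ψ (q j))).symm.trans ?_
  rw [← Nakayama.eval_nakayamaMap, hf, map_zero]

open scoped ModuleCat.Algebra in
-- If φ is not in the image of Hom(Q, N), the cogenerator gives a functional α that kills the image
-- but not φ. It corresponds to f : x ↦ (g ↦ α(g(-)x)), which satisfies ν(d) ∘ f = 0. So f = 0, and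
-- expanding φ in a dual basis gives α(φ) = 0.
theorem exists_comp_eq_of_forall_nakayama_eq_zero [IsArtinianRing R] {P Q : Type u}
    [AddCommGroup P] [Module Λ P] [AddCommGroup Q] [Module Λ Q] (N : ModuleCat.{u} Λ)
    [Module.Finite Λ P] [Module.Projective Λ P] (d : P →ₗ[Λ] Q)
    (h : ∀ f : N →ₗ[Λ] Nakayama R Λ P, (∀ x, nakayamaMap d (f x) = 0) → f = 0)
    (φ : P →ₗ[Λ] N) : ∃ ψ : Q →ₗ[Λ] N, ψ ∘ₗ d = φ := by
  let D : (Q →ₗ[Λ] N) →ₗ[R] (P →ₗ[Λ] N) :=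
    { toFun := fun ψ => ψ ∘ₗ d
      map_add' := fun _ _ => rfl
      map_smul' := fun _ _ => rfl }
  by_contra hφ
  have hne : Submodule.Quotient.mk (p := LinearMap.range D) φ ≠ 0 := fun h0 =>
    hφ ((Submodule.Quotient.mk_eq_zero _).1 h0)
  obtain ⟨β, hβ⟩ := exists_dualizing_ne_zero (R := R) _ _ hne
  let α : (P →ₗ[Λ] N) →ₗ[R] dualizing R := β ∘ₗ (LinearMap.range D).mkQ
  have hα (ψ : Q →ₗ[Λ] N) : α (ψ ∘ₗ d) = 0 := by
    have : (LinearMap.range D).mkQ (ψ ∘ₗ d) = 0 :=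
      (Submodule.Quotient.mk_eq_zero _).2 ⟨ψ, rfl⟩
    simp only [α, LinearMap.comp_apply, this, map_zero]
  let E (x : N) : (P →ₗ[Λ] Λ) →ₗ[R] (P →ₗ[Λ] N) :=
    { toFun := fun g => LinearMap.toSpanSingleton Λ N x ∘ₗ g
      map_add' := fun g g' => LinearMap.comp_add _ _ _
      map_smul' := fun r g => by
        ext y
        exact smul_assoc r (g y) x }
  let f : N →ₗ[Λ] Nakayama R Λ P :=
    { toFun := fun x => (α ∘ₗ E x : (P →ₗ[Λ] Λ) →ₗ[R] dualizing R)
      map_add' := fun x y => Nakayama.ext fun g => by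
        change α (E (x + y) g) = α (E x g) + α (E y g)
        rw [← map_add]
        congr 1
        ext z
        exact smul_add _ _ _
      map_smul' := fun a x => Nakayama.ext fun g => by
        change α (E (a • x) g) = α (E x (MulOpposite.op a • g))
        congr 1
        ext z
        exact (mul_smul (g z) a x).symm }
  have hf : f = 0 := h f fun x => Nakayama.ext fun g => hα (LinearMap.toSpanSingleton Λ N x ∘ₗ g)
  obtain ⟨k, p, b, hb⟩ := exists_dualBasis (Λ := Λ) P
  have hsum : φ = ∑ a, E (φ (p a)) (b a) := by
    ext y
    conv_lhs => rw [← hb y]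
    rw [map_sum, LinearMap.sum_apply]
    exact Finset.sum_congr rfl fun a _ => map_smul φ _ _
  have h0 : α φ = 0 := by
    rw [hsum, map_sum]
    exact Finset.sum_eq_zero fun a _ =>
      congrArg (fun f : N →ₗ[Λ] Nakayama R Λ P => Nakayama.eval (b a) (f (φ (p a)))) hf
  exact hβ h0

end NakayamaDuality

/-! ### Uniqueness of minimal presentations -/

section MinimalPresentations

variable {Λ : Type u} [Ring Λ]

/-- Uniqueness of projective covers: a lift f : P → Q of p is onto because ker q is superfluous, and
a section of f is onto because ker p is, so f is bijective. -/
theorem exists_equiv_of_isSuperfluous_ker {P Q X : Type*} [AddCommGroup P] [Module Λ P]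
    [AddCommGroup Q] [Module Λ Q] [AddCommGroup X] [Module Λ X] [Module.Projective Λ P]
    [Module.Projective Λ Q] {p : P →ₗ[Λ] X} {q : Q →ₗ[Λ] X} (hp : Function.Surjective p)
    (hq : Function.Surjective q) (hp' : IsSuperfluous (LinearMap.ker p))
    (hq' : IsSuperfluous (LinearMap.ker q)) : ∃ e : P ≃ₗ[Λ] Q, ∀ x, q (e x) = p x := by
  obtain ⟨f, hf⟩ := Module.projective_lifting_property q p hq
  have hf (x : P) : q (f x) = p x := LinearMap.congr_fun hf x
  have hfs : Function.Surjective f := by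
    refine LinearMap.range_eq_top.1 (hq' _ (eq_top_iff.2 fun y _ => ?_))
    obtain ⟨x, hx⟩ := hp (q y)
    refine Submodule.mem_sup.2 ⟨y - f x, ?_, f x, ⟨x, rfl⟩, sub_add_cancel _ _⟩
    rw [LinearMap.mem_ker, map_sub, hf, hx, sub_self]
  obtain ⟨s, hs⟩ := Module.projective_lifting_property f LinearMap.id hfs
  have hs (y : Q) : f (s y) = y := LinearMap.congr_fun hs y
  have hss : Function.Surjective s := by
    refine LinearMap.range_eq_top.1 (hp' _ (eq_top_iff.2 fun x _ => ?_))
    refine Submodule.mem_sup.2 ⟨x - s (f x), ?_, s (f x), ⟨f x, rfl⟩, sub_add_cancel _ _⟩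
    rw [LinearMap.mem_ker, ← hf, map_sub, hs, sub_self, map_zero]
  have hfi : Function.Injective f := by
    intro x y hxy
    obtain ⟨x, rfl⟩ := hss x
    obtain ⟨y, rfl⟩ := hss y
    rw [hs, hs] at hxy
    rw [hxy]
  exact ⟨LinearEquiv.ofBijective f ⟨hfi, hfs⟩, hf⟩

/-- The surjectivity of `Hom(P₀, N) → Hom(P₁, N)` does not depend on the minimal projective
presentation `P₁ → P₀ → X → 0`. -/
theorem exists_comp_eq_of_minimal_presentations {A₁ A₀ B₁ B₀ X N : Type*} [AddCommGroup A₁]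
    [Module Λ A₁] [AddCommGroup A₀] [Module Λ A₀] [AddCommGroup B₁] [Module Λ B₁] [AddCommGroup B₀]
    [Module Λ B₀] [AddCommGroup X] [Module Λ X] [AddCommGroup N] [Module Λ N]
    [Module.Projective Λ A₁] [Module.Projective Λ A₀] [Module.Projective Λ B₁]
    [Module.Projective Λ B₀] {a : A₁ →ₗ[Λ] A₀} {p : A₀ →ₗ[Λ] X} {b : B₁ →ₗ[Λ] B₀} {q : B₀ →ₗ[Λ] X}
    (hp : Function.Surjective p) (hq : Function.Surjective q) (hap : Function.Exact a p)
    (hbq : Function.Exact b q) (hp' : IsSuperfluous (LinearMap.ker p))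
    (hq' : IsSuperfluous (LinearMap.ker q)) (ha' : IsSuperfluous (LinearMap.ker a))
    (hb' : IsSuperfluous (LinearMap.ker b))
    (h : ∀ φ : A₁ →ₗ[Λ] N, ∃ ψ : A₀ →ₗ[Λ] N, ψ ∘ₗ a = φ) (φ : B₁ →ₗ[Λ] N) :
    ∃ ψ : B₀ →ₗ[Λ] N, ψ ∘ₗ b = φ := by
  obtain ⟨e, he⟩ := exists_equiv_of_isSuperfluous_ker hp hq hp' hq'
  have hab (x : A₁) : e (a x) ∈ LinearMap.range b :=
    (hbq _).1 ((he _).trans (hap.apply_apply_eq_zero x))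
  have hsurj : Function.Surjective ((e.toLinearMap ∘ₗ a).codRestrict _ hab) := by
    rintro ⟨_, y, rfl⟩
    obtain ⟨x, hx⟩ := (hap (e.symm (b y))).1 (by
      rw [← he, e.apply_symm_apply, hbq.apply_apply_eq_zero])
    exact ⟨x, Subtype.ext (by simp [hx])⟩
  obtain ⟨e', he'⟩ := exists_equiv_of_isSuperfluous_ker hsurj
    b.surjective_rangeRestrict (by
      rwa [LinearMap.ker_codRestrict, LinearMap.ker_comp_of_ker_eq_bot _ e.ker])
    (by rwa [LinearMap.ker_rangeRestrict])
  obtain ⟨ψ, hψ⟩ := h (φ ∘ₗ e'.toLinearMap)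
  refine ⟨ψ ∘ₗ e.symm.toLinearMap, ?_⟩
  ext y
  obtain ⟨x, rfl⟩ := e'.surjective y
  have h1 : b (e' x) = e (a x) := congrArg Subtype.val (he' x)
  have h2 := LinearMap.congr_fun hψ x
  simpa [h1] using h2

end MinimalPresentations

/-! ### The perpendicular category as an exactness condition -/

section Perpendicular

variable (R : Type u) {Λ : Type u} [CommRing R] [Ring Λ] [Algebra R Λ] [IsArtinAlgebra R Λ]
  (M : ModuleCat.{u} Λ) [Module.Finite Λ M]

/-- Makes P_{m+1} → P_m → Ω^m(M) → 0 a minimal presentation, uniformly over the three cases in the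
definition of `syzygy`. -/
theorem exists_surjective_syzygy (m : ℕ) :
    ∃ p : (minRes R Λ M).complex.X m →ₗ[Λ] syzygy R Λ M m, Function.Surjective p ∧
      IsSuperfluous (LinearMap.ker p) ∧
      Function.Exact ((minRes R Λ M).complex.d (m + 1) m).hom p := by
  have hmin := isMinimalResolution_minRes R Λ M
  have key {P Q X : Type u} [AddCommGroup P] [Module Λ P] [AddCommGroup Q] [Module Λ Q]
      [AddCommGroup X] [Module Λ X] {W : Type u} [AddCommGroup W] [Module Λ W] {c : W →ₗ[Λ] P}
      {a : P →ₗ[Λ] Q} {b : Q →ₗ[Λ] X} (hab : Function.Exact a b) (hca : Function.Exact c a)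
      (ha : IsSuperfluous (LinearMap.ker a)) :
      ∃ p : P →ₗ[Λ] LinearMap.ker b, Function.Surjective p ∧ IsSuperfluous (LinearMap.ker p) ∧
        Function.Exact c p := by
    refine ⟨a.codRestrict _ fun x => LinearMap.mem_ker.2 (hab.apply_apply_eq_zero x), ?_, ?_, fun x => ?_⟩
    · rintro ⟨y, hy⟩
      obtain ⟨x, rfl⟩ := (hab y).1 hy
      exact ⟨x, rfl⟩
    · rwa [LinearMap.ker_codRestrict]
    · rw [← hca x]
      exact Subtype.ext_iff
  match m with
  | 0 => exact ⟨(augmentation (minRes R Λ M)).hom, augmentation_surjective _,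
      hmin.superfluous_zero, exact_augmentation _⟩
  | 1 => exact key (exact_augmentation (minRes R Λ M)) (exact_d _ 0) (hmin.superfluous_succ 0)
  | i + 2 =>
    exact key (exact_d (minRes R Λ M) i) (exact_d _ (i + 1)) (hmin.superfluous_succ (i + 1))

instance projective_minRes_X (i : ℕ) : Module.Projective Λ ((minRes R Λ M).complex.X i) :=
  (IsProjective.iff_projective _).2 ((minRes R Λ M).projective i)

/-- Hom(N, τX) is the kernel of Hom(N, ν(P_1)) → Hom(N, ν(P_0)), which by duality vanishes exactly
when Hom(P_0, N) → Hom(P_1, N) is onto. -/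
theorem hom_tau_eq_zero_iff (X N : ModuleCat.{u} Λ) [Module.Finite Λ X] :
    (∀ f : N ⟶ tau R Λ X, f = 0) ↔ ∀ φ : (minRes R Λ X).complex.X 1 →ₗ[Λ] N,
      ∃ ψ : (minRes R Λ X).complex.X 0 →ₗ[Λ] N, ψ ∘ₗ ((minRes R Λ X).complex.d 1 0).hom = φ := by
  have := IsArtinAlgebra.isArtinianRing_base (R := R) (Λ := Λ)
  have := (isMinimalResolution_minRes R Λ X).finite
  constructor
  · refine fun h => exists_comp_eq_of_forall_nakayama_eq_zero (R := R) N _ fun f hf => ?_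
    have h0 := h (ModuleCat.ofHom (f.codRestrict _ hf))
    ext x : 1
    exact congrArg Subtype.val (LinearMap.congr_fun (congrArg ModuleCat.Hom.hom h0) x)
  · intro h f
    have h0 := eq_zero_of_nakayamaMap_comp_eq_zero (R := R) _ h
      ((LinearMap.ker (nakayamaMap (R := R) ((minRes R Λ X).complex.d 1 0).hom)).subtype ∘ₗ f.hom)
      fun x => (f.hom x).2
    ext x
    exact Subtype.ext (LinearMap.congr_fun h0 x)

/-- τ_{m+1}(M) is computed from the fixed resolution of Ω^m(M), which need not be the tail of that
of M. Both give minimal presentations of Ω^m(M), so the surjectivity condition can be transported.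
-/
theorem hom_tauN_eq_zero_iff (N : ModuleCat.{u} Λ) (m : ℕ) :
    (∀ f : N ⟶ tauN R Λ M (m + 1), f = 0) ↔ ∀ φ : (minRes R Λ M).complex.X (m + 1) →ₗ[Λ] N,
      ∃ ψ : (minRes R Λ M).complex.X m →ₗ[Λ] N,
        ψ ∘ₗ ((minRes R Λ M).complex.d (m + 1) m).hom = φ := by
  obtain ⟨p, hp, hp', hdp⟩ := exists_surjective_syzygy R M m
  have hX := isMinimalResolution_minRes R Λ (syzygy R Λ M m)
  have hM := isMinimalResolution_minRes R Λ M
  refine (hom_tau_eq_zero_iff R (syzygy R Λ M m) N).trans ⟨fun h => ?_, fun h => ?_⟩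
  · exact exists_comp_eq_of_minimal_presentations (augmentation_surjective (minRes R Λ _)) hp
      (exact_augmentation _) hdp hX.superfluous_zero hp' (hX.superfluous_succ 0)
      (hM.superfluous_succ m) h
  · exact exists_comp_eq_of_minimal_presentations hp (augmentation_surjective (minRes R Λ _))
      hdp (exact_augmentation _) hp' hX.superfluous_zero (hM.superfluous_succ m)
      (hX.superfluous_succ 0) h

theorem tauPerp_iff (n : ℕ) (hn : 1 ≤ n) (N : ModuleCat.{u} Λ) :
    tauPerp R Λ M n N ↔ Module.Finite Λ N ∧ HomExact (minRes R Λ M).complex n N 0 := by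
  obtain ⟨m, rfl⟩ := Nat.exists_eq_add_of_le' hn
  refine and_congr_right fun _ => ?_
  rw [hom_tauN_eq_zero_iff]
  constructor
  · rintro ⟨h, hext⟩ i - hi φ hφ
    -- The top degree i + 1 = n carries no cocycle condition and is the τ_n part; lower degrees are
    -- Ext^{i+1}.
    by_cases him : i = m
    · subst him
      obtain ⟨ψ, hψ⟩ := h φ.hom
      exact ⟨ModuleCat.ofHom ψ, ModuleCat.hom_ext hψ⟩
    · exact (subsingleton_ext_iff (minRes R Λ M) N i).1 (hext (i + 1) (by lia) (by lia)) φ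
        (hφ (by lia))
  · refine fun h => ⟨fun φ => ?_, fun i hi hi' => ?_⟩
    · obtain ⟨ψ, hψ⟩ := h m (by lia) le_rfl (ModuleCat.ofHom φ) fun h => by lia
      exact ⟨ψ.hom, congrArg ModuleCat.Hom.hom hψ⟩
    · obtain ⟨i, rfl⟩ := Nat.exists_eq_add_of_le' hi
      exact (subsingleton_ext_iff (minRes R Λ M) N i).2 fun φ hφ =>
        h i (by lia) (by lia) φ fun _ => hφ

end Perpendicular

end TauTilting

/-! ### The main theorem -/

theorem mainTheorem3 (R Λ : Type u) [CommRing R] [Ring Λ] [Algebra R Λ]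
    [TauTilting.IsArtinAlgebra R Λ] (M : ModuleCat.{u} Λ) [Module.Finite Λ M]
    (n : ℕ) (hn : 1 ≤ n) (hM : TauTilting.IsTauTilting R Λ M n) :
    TauTilting.tauPerp R Λ M n = TauTilting.gen Λ M n := by
  have hMM := TauTilting.homExact_of_vanishesAbove hM.1.vanishesAbove
  ext N
  rw [TauTilting.tauPerp_iff R M n hn N]
  constructor
  · rintro ⟨_, hN⟩
    exact TauTilting.gen_of_homExact (R := R) (TauTilting.minRes R Λ M) n hMM
      (fun _ hN x => TauTilting.exists_sum_eq_of_isSilting R hn hM hN x) hN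
  · exact fun hN => ⟨hN.1, TauTilting.homExact_of_gen hMM hN⟩
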